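/- All graphs are finite, simple and undirected. For a connected graph $G$, let $G^2$ be its square, i.e. the graph on $V(G)$ in which two distinct vertices are adjacent if and only if their distance in $G$ is at most $2$, and let $\rho(H)$ denote the spectral radius of the adjacency matrix of a graph $H$. A unicyclic graph is a connected graph containing exactly one cycle. Let $P_m$ and $C_m$ be the path and the cycle on $m$ vertices, and let $C_3(v)\circ P_{n-2}(v)$ be the graph of order $n$ obtained from disjoint copies of $C_3$ and $P_{n-2}$ by identifying a vertex of $C_3$ with an end (degree-one) vertex of $P_{n-2}$. Theorem. For every unicyclic graph $U$ of order $n\ge 4$, $$\rho(U^2)\ \ge\ \min\bigl\{\rho\bigl((C_3(v)\circ P_{n-2}(v))^2\bigr),\ \rho(C_n^2)\bigr\}.$$ Equality holds if and only if $U$ is isomorphic to one of the two graphs $C_3(v)\circ P_{n-2}(v)$, $C_n$ and that graph attains the minimum on the right-hand side; that is, if and only if either $U\cong C_3(v)\circ P_{n-2}(v)$ and $\rho\bigl((C_3(v)\circ P_{n-2}(v))^2\bigr)\le\rho(C_n^2)$, or $U\cong C_n$ and $\rho(C_n^2)\le\rho\bigl((C_3(v)\circ P_{n-2}(v))^2\bigr)$.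 -/

import Mathlib

namespace SquareSpectral

/-- A graph is *unicyclic* if it is connected and contains exactly one cycle.
Cycles are identified with the subgraphs traced out by closed walks that are cycles, so that
the starting point and the orientation of the walk do not matter. -/
def IsUnicyclic {V : Type*} (G : SimpleGraph V) : Prop :=
  G.Connected ∧ ∃! H : G.Subgraph, ∃ (v : V) (p : G.Walk v v), p.IsCycle ∧ p.toSubgraph = H

/-- The `k`-th power of a graph: distinct vertices are adjacent iff their distance is at most `k`.
The extended distance is used, so vertices in different components stay nonadjacent. -/
def graphPower {V : Type*} (G : SimpleGraph V) (k : ℕ) : SimpleGraph V where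
  Adj u v := u ≠ v ∧ G.edist u v ≤ k
  symm := ⟨fun u v h => ⟨h.1.symm, by rw [SimpleGraph.edist_comm]; exact h.2⟩⟩
  loopless := ⟨fun _ h => h.1 rfl⟩

open Classical in
/-- The spectral radius `ρ(G)` of a finite graph: the spectral radius of its real adjacency
matrix. -/
noncomputable def rho {V : Type*} [Fintype V] (G : SimpleGraph V) : ENNReal :=
  spectralRadius ℝ (G.adjMatrix ℝ)

/-- The coalescence `G₁(v₁) ∘ G₂(v₂)`, obtained from the disjoint union of `G₁` and `G₂` by
identifying `v₁` with `v₂`. The identified vertex is represented by `Sum.inl v₁`. -/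
def coalescence {V₁ V₂ : Type*} (G₁ : SimpleGraph V₁) (v₁ : V₁) (G₂ : SimpleGraph V₂) (v₂ : V₂) :
    SimpleGraph (V₁ ⊕ {w : V₂ // w ≠ v₂}) where
  Adj
    | Sum.inl a, Sum.inl b => G₁.Adj a b
    | Sum.inr x, Sum.inr y => G₂.Adj x.1 y.1
    | Sum.inl a, Sum.inr x => a = v₁ ∧ G₂.Adj v₂ x.1
    | Sum.inr x, Sum.inl a => a = v₁ ∧ G₂.Adj v₂ x.1
  symm := ⟨by
    rintro (a | x) (b | y) h
    · exact SimpleGraph.Adj.symm h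
    · exact h
    · exact h
    · exact SimpleGraph.Adj.symm h⟩
  loopless := ⟨by
    rintro (a | x) h
    · exact G₁.irrefl h
    · exact G₂.irrefl h⟩

/-- `v` is a pendant (end) vertex of `G`: it has exactly one neighbour. -/
def IsPendant {V : Type*} (G : SimpleGraph V) (v : V) : Prop :=
  ∃! w, G.Adj v w

/-- `ρ(G²)`, the spectral radius of the square of `G`. -/
noncomputable def rhoSq {V : Type*} [Fintype V] (G : SimpleGraph V) : ENNReal :=
  rho (graphPower G 2)

/-- The graph `C₃(c) ∘ P_{n-2}(v)`, the coalescence of a triangle and a path at the vertices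
`c` and `v`. -/
def trianglePath (n : ℕ) (c : Fin 3) (v : Fin (n - 2)) :
    SimpleGraph (Fin 3 ⊕ {w : Fin (n - 2) // w ≠ v}) :=
  coalescence (SimpleGraph.cycleGraph 3) c (SimpleGraph.pathGraph (n - 2)) v

end SquareSpectral

/-! If every degree is at most two, a unicyclic graph is a cycle, so the claim concerns graphs `U`
with a vertex of degree at least three. Among these the lollipop (a triangle with a pendant path) is
the unique minimiser.

The key remark is that the lollipop and the fork (the lollipop without the edge joining its two
vertices of degree two) have the same square, because those vertices have a common neighbour. The
square of a lollipop has spectral radius below 4 (`IsLolliPerron.lt_four`), so only graphs with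
`ρ(U²) < 4` matter. In such a `U` a star on four vertices is grown to a spanning tree one vertex at
a time. Explicit test vectors rule out every step that forces the value 4, which leaves a short list
(`exists_lowCopy`): forks, double forks, and trees with one branch vertex and arms 1,2,k or 1,3,k (3
≤ k ≤ 5) or 2,2,2 or 2,2,3.

All but the fork beat the lollipop strictly (`IsLolliPerron.lt_or_spanningFork`). A double fork adds
an edge to its square. Arms 1,2,k replace one edge by another on which the Perron vector is heavier.
The remaining trees have bounded order and are separated by numerical bounds.

If `U` has a spanning fork, then `U²` contains the square of the lollipop. For `n ≥ 5`, equality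
forbids any further edge in `U²`, hence any chord of the fork except the one closing the triangle.
That chord must be present because `U` has a cycle (`IsSpanningFork.iso_lollipop_of_sq`). For `n =
4` the square is complete, and the graph is identified directly. -/

namespace SquareSpectral
open Finset

/-! ### Quadratic forms, Perron vectors and the spectral radius. -/

open Classical in
/-- The adjacency indicator of a graph, as a real number. -/
noncomputable def adjInd {V : Type*} (G : SimpleGraph V) (u v : V) : ℝ :=
  if G.Adj u v then 1 else 0

section adjInd
variable {V : Type*} (G : SimpleGraph V) (u v : V)

lemma adjInd_nonneg : 0 ≤ adjInd G u v := by
  unfold adjInd; split_ifs <;> norm_num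

lemma adjInd_comm : adjInd G u v = adjInd G v u := by
  simp only [adjInd]; rw [G.adj_comm]

lemma adjInd_self : adjInd G u u = 0 := by simp [adjInd]

variable {G u v}

lemma adjInd_of_adj (h : G.Adj u v) : adjInd G u v = 1 := by simp [adjInd, h]

lemma adjInd_of_not_adj (h : ¬ G.Adj u v) : adjInd G u v = 0 := by simp [adjInd, h]

end adjInd

/-- The quadratic form of the adjacency matrix. -/
noncomputable def quad {V : Type*} [Fintype V] (G : SimpleGraph V) (x : V → ℝ) : ℝ :=
  ∑ u, ∑ v, adjInd G u v * (x u * x v)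

lemma quad_smul {V : Type*} [Fintype V] (G : SimpleGraph V) (c : ℝ) (x : V → ℝ) :
    quad G (fun u => c * x u) = c ^ 2 * quad G x := by
  simp only [quad, mul_sum]
  exact sum_congr rfl fun u _ => sum_congr rfl fun v _ => by ring

lemma quad_le_quad_abs {V : Type*} [Fintype V] (G : SimpleGraph V) (x : V → ℝ) :
    |quad G x| ≤ quad G (fun u => |x u|) := by
  unfold quad
  refine (abs_sum_le_sum_abs _ _).trans (sum_le_sum fun u _ => ?_)
  refine (abs_sum_le_sum_abs _ _).trans (sum_le_sum fun v _ => ?_)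
  rw [abs_mul, abs_mul, abs_of_nonneg (adjInd_nonneg G u v)]

/-- A maximiser of the Rayleigh quotient is an eigenvector. -/
lemma eigen_of_quad_eq {V : Type*} [Fintype V] (G : SimpleGraph V) {l : ℝ}
    (hl : ∀ x : V → ℝ, quad G x ≤ l * ∑ u, x u ^ 2) {z : V → ℝ}
    (hz : quad G z = l * ∑ u, z u ^ 2) (u : V) : ∑ v, adjInd G u v * z v = l * z u := by
  classical
  -- Vary `z` in the coordinate `u` only. There are no loops, so the form has no `t ^ 2` term.
  have key : ∀ t : ℝ, 0 ≤ t * (2 * (l * z u - ∑ v, adjInd G u v * z v)) + t ^ 2 * l := by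
    intro t
    have h := hl (fun v => z v + t * (if v = u then 1 else 0))
    have e1 : ∑ v, (z v + t * (if v = u then 1 else 0)) ^ 2
        = ∑ v, z v ^ 2 + 2 * t * z u + t ^ 2 := by
      have : ∀ v, (z v + t * (if v = u then (1:ℝ) else 0)) ^ 2
          = z v ^ 2 + (if v = u then 2 * t * z u + t ^ 2 else 0) := by
        intro v; split_ifs with h
        · subst h; ring
        · ring
      simp only [this, sum_add_distrib, sum_ite_eq', mem_univ, if_true]; ring
    have e2 : quad G (fun v => z v + t * (if v = u then 1 else 0))
        = quad G z + 2 * t * ∑ v, adjInd G u v * z v := by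
      have : ∀ a b, adjInd G a b * ((z a + t * (if a = u then 1 else 0)) *
          (z b + t * (if b = u then 1 else 0))) = adjInd G a b * (z a * z b)
          + ((if a = u then t * (adjInd G u b * z b) else 0)
          + (if b = u then t * (adjInd G u a * z a) else 0)) := by
        intro a b
        split_ifs with h1 h2 h2
        · subst h1; subst h2; rw [adjInd_self]; ring
        · subst h1; ring
        · subst h2; rw [adjInd_comm G a b]; ring
        · ring
      simp only [quad, this, sum_add_distrib, sum_ite_eq', mem_univ, if_true]
      rw [sum_comm (f := fun a b => if a = u then t * (adjInd G u b * z b) else 0)]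
      simp only [sum_ite_eq', mem_univ, if_true, ← mul_sum]; ring
    rw [e1, e2, hz] at h
    nlinarith
  set d := l * z u - ∑ v, adjInd G u v * z v with hd
  have h1 := key 1
  by_contra hne
  have hd0 : d ≠ 0 := fun h => hne (by linarith)
  have hpos : 0 < |l| + 1 := by positivity
  -- A step against the sign of `d`, short enough that the linear term dominates: `l - 2 * (|l| + 1)
  -- < 0`.
  have h2 := key (-d / (|l| + 1))
  have h3 : -d / (|l| + 1) * (2 * d) + (-d / (|l| + 1)) ^ 2 * l
      = d ^ 2 / (|l| + 1) ^ 2 * (l - 2 * (|l| + 1)) := by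
    field_simp; ring
  rw [h3] at h2
  have h4 : 0 < d ^ 2 / (|l| + 1) ^ 2 := by positivity
  nlinarith [le_abs_self l, abs_nonneg l]

/-- The Perron–Frobenius facts about the spectral radius that hold for every graph. -/
theorem exists_perron {V : Type*} [Fintype V] [Nonempty V] (G : SimpleGraph V) :
    ∃ l : ℝ, 0 ≤ l ∧ rho G = ENNReal.ofReal l ∧
      (∀ x : V → ℝ, quad G x ≤ l * ∑ u, x u ^ 2) ∧
      ∃ z : V → ℝ, (∀ u, 0 ≤ z u) ∧ z ≠ 0 ∧ ∀ u, ∑ v, adjInd G u v * z v = l * z u := by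
  classical
  obtain ⟨u₀⟩ := ‹Nonempty V›
  have hcont : Continuous (quad G) := by unfold quad; fun_prop
  have hcomp : IsCompact {x : V → ℝ | ∑ u, x u ^ 2 = 1} := by
    refine Metric.isCompact_of_isClosed_isBounded
      (isClosed_eq (by fun_prop) continuous_const) ?_
    refine (Metric.isBounded_closedBall (x := (0 : V → ℝ)) (r := 1)).subset fun x hx => ?_
    rw [mem_closedBall_zero_iff, pi_norm_le_iff_of_nonneg zero_le_one]
    intro u
    have : x u ^ 2 ≤ 1 := by
      rw [← (hx : ∑ u, x u ^ 2 = 1)]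
      exact single_le_sum (f := fun u => x u ^ 2) (fun _ _ => sq_nonneg _) (mem_univ u)
    rw [Real.norm_eq_abs]
    exact (sq_le_one_iff_abs_le_one _).1 this
  obtain ⟨x₀, hx₀, hmax⟩ := hcomp.exists_isMaxOn
    ⟨Pi.single u₀ 1, by simp [Pi.single_apply, ite_pow]⟩ hcont.continuousOn
  have hx₀' : ∑ u, x₀ u ^ 2 = 1 := hx₀
  set l := quad G x₀ with hl
  have hR : ∀ x : V → ℝ, quad G x ≤ l * ∑ u, x u ^ 2 := by
    intro x
    rcases (sum_nonneg fun u _ => sq_nonneg (x u) : 0 ≤ ∑ u, x u ^ 2).eq_or_lt with h0 | h0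
    · have : ∀ u, x u = 0 := fun u => by
        have := (sum_eq_zero_iff_of_nonneg (fun u _ => sq_nonneg (x u))).1 h0.symm u (mem_univ u)
        exact pow_eq_zero_iff (two_ne_zero) |>.1 this
      rw [← h0]; simp [quad, this]
    · set N := ∑ u, x u ^ 2
      have hs := Real.sq_sqrt h0.le
      have hs0 : 0 < √N := Real.sqrt_pos.2 h0
      have hm := hmax (show (fun u => (√N)⁻¹ * x u) ∈ {x : V → ℝ | ∑ u, x u ^ 2 = 1} by
        show ∑ u, ((√N)⁻¹ * x u) ^ 2 = 1
        simp only [mul_pow, ← mul_sum, inv_pow, hs]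
        exact inv_mul_cancel₀ h0.ne')
      have hm' : quad G (fun u => (√N)⁻¹ * x u) ≤ l := hm
      rw [quad_smul, inv_pow, hs, inv_mul_le_iff₀ h0] at hm'
      linarith
  have hsqabs : ∀ x : V → ℝ, ∑ u, |x u| ^ 2 = ∑ u, x u ^ 2 := fun x => by simp
  have hl0 : 0 ≤ l := by
    have := hR (Pi.single u₀ 1)
    have h1 : quad G (Pi.single u₀ 1) = 0 := by
      unfold quad
      refine sum_eq_zero fun u _ => sum_eq_zero fun v _ => ?_
      by_cases hu : u = u₀
      · by_cases hv : v = u₀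
        · rw [hu, hv, adjInd_self]; ring
        · simp [hv]
      · simp [hu]
    rw [h1] at this
    simpa [Pi.single_apply, ite_pow] using this
  -- Absolute values keep the norm and do not lower the form, so `|x₀|` is a maximiser as well.
  have habs : quad G (fun u => |x₀ u|) = l * ∑ u, |x₀ u| ^ 2 := by
    refine le_antisymm (hR _) ?_
    rw [hsqabs, hx₀', mul_one]
    exact (le_abs_self _).trans (quad_le_quad_abs G x₀)
  have hne : (fun u => |x₀ u|) ≠ 0 := by
    intro h
    have : ∀ u, x₀ u = 0 := fun u => abs_eq_zero.1 (congrFun h u)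
    simp [this] at hx₀'
  have heig := eigen_of_quad_eq G hR habs
  have hmul : ∀ x : V → ℝ, (G.adjMatrix ℝ).mulVec x = fun u => ∑ v, adjInd G u v * x v := by
    intro x; ext u
    simp [Matrix.mulVec, dotProduct, adjInd, SimpleGraph.adjMatrix_apply]
  refine ⟨l, hl0, ?_, hR, _, fun u => abs_nonneg _, hne, heig⟩
  have hspec : ∀ m : ℝ, m ∈ spectrum ℝ (G.adjMatrix ℝ) ↔
      ∃ x : V → ℝ, x ≠ 0 ∧ (G.adjMatrix ℝ).mulVec x = m • x := by
    intro m
    rw [← Matrix.spectrum_toLin', ← Module.End.hasEigenvalue_iff_mem_spectrum]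
    constructor
    · intro h
      obtain ⟨x, hx⟩ := h.exists_hasEigenvector
      exact ⟨x, hx.2, by simpa using hx.apply_eq_smul⟩
    · rintro ⟨x, hx, h⟩
      exact Module.End.hasEigenvalue_of_hasEigenvector
        (Module.End.hasEigenvector_iff.2 ⟨Module.End.mem_eigenspace_iff.2 (by simpa using h), hx⟩)
  unfold rho spectralRadius
  refine le_antisymm (iSup₂_le fun m hm => ?_) ?_
  · obtain ⟨x, hx, h⟩ := (hspec m).1 (by convert hm)
    rw [hmul] at h
    have hq : quad G x = m * ∑ u, x u ^ 2 := by
      unfold quad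
      rw [mul_sum]
      refine sum_congr rfl fun u _ => ?_
      have := congrFun h u
      simp only [Pi.smul_apply, smul_eq_mul] at this
      calc ∑ v, adjInd G u v * (x u * x v) = x u * ∑ v, adjInd G u v * x v := by
            rw [mul_sum]; exact sum_congr rfl fun v _ => by ring
        _ = m * x u ^ 2 := by rw [this]; ring
    have hpos : 0 < ∑ u, x u ^ 2 := by
      obtain ⟨u, hu⟩ := Function.ne_iff.1 hx
      exact sum_pos' (fun _ _ => sq_nonneg _) ⟨u, mem_univ u, by have : x u ≠ 0 := hu; positivity⟩
    have h1 := (quad_le_quad_abs G x).trans (hR _)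
    rw [hsqabs, hq, abs_mul, abs_of_pos hpos] at h1
    have h2 : |m| ≤ l := le_of_mul_le_mul_right h1 hpos
    show ‖m‖ₑ ≤ _
    rw [← ofReal_norm]
    exact ENNReal.ofReal_le_ofReal (by simpa using h2)
  · have hm : l ∈ spectrum ℝ (G.adjMatrix ℝ) := (hspec l).2 ⟨_, hne, by
      rw [hmul]; ext u; exact heig u⟩
    refine le_trans ?_ (le_iSup₂ (f := fun k (_ : k ∈ spectrum ℝ _) => (‖k‖₊ : ENNReal)) l
      (by convert hm))
    show _ ≤ ‖l‖ₑ
    rw [← ofReal_norm, Real.norm_of_nonneg hl0]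

/-- A nonnegative eigenvector of a connected graph is positive. -/
lemma eigenvector_pos {V : Type*} [Fintype V] {G : SimpleGraph V} (hG : G.Preconnected)
    {l : ℝ} {z : V → ℝ} (hz : ∀ u, 0 ≤ z u) (hne : z ≠ 0)
    (heig : ∀ u, ∑ v, adjInd G u v * z v = l * z u) (u : V) : 0 < z u := by
  refine lt_of_le_of_ne (hz u) fun h0 => hne ?_
  have step : ∀ a b, G.Adj a b → z a = 0 → z b = 0 := by
    intro a b hab ha
    have h := heig a
    rw [ha, mul_zero, sum_eq_zero_iff_of_nonneg
      (fun v _ => mul_nonneg (adjInd_nonneg _ _ _) (hz v))] at h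
    simpa [adjInd_of_adj hab] using h b (mem_univ b)
  ext v
  obtain ⟨p⟩ := hG u v
  have walk : ∀ {a b} (p : G.Walk a b), z a = 0 → z b = 0 := by
    intro a b p
    induction p with
    | nil => exact id
    | cons h _ ih => exact fun ha => ih (step _ _ h ha)
  exact walk p h0.symm

/-- The quadratic form of a vector transported along an injection. -/
lemma quad_extend {V ι : Type*} [Fintype V] [Fintype ι] (G : SimpleGraph V) {f : ι → V}
    (hf : Function.Injective f) (x : ι → ℝ) :
    quad G (Function.extend f x 0) = ∑ i, ∑ j, adjInd G (f i) (f j) * (x i * x j) := by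
  have h0 : ∀ v ∉ Set.range f, Function.extend f x 0 v = 0 := fun v hv => by
    rw [Function.extend_apply' _ _ _ hv]; rfl
  refine (Fintype.sum_of_injective f hf _ _ (fun v hv => ?_) fun i => ?_).symm
  · simp [h0 v hv]
  · refine Fintype.sum_of_injective f hf _ _ (fun v hv => ?_) fun j => ?_
    · simp [h0 v hv]
    · simp [hf.extend_apply]

lemma sum_sq_extend {V ι : Type*} [Fintype V] [Fintype ι] {f : ι → V}
    (hf : Function.Injective f) (x : ι → ℝ) :
    ∑ v, Function.extend f x 0 v ^ 2 = ∑ i, x i ^ 2 := by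
  refine (Fintype.sum_of_injective f hf _ _ (fun v hv => ?_) fun i => ?_).symm
  · rw [Function.extend_apply' _ _ _ hv]; simp
  · rw [hf.extend_apply]

/-- The Rayleigh bound for a weighted family of distinct vertices. -/
lemma rayleigh_of_injective {V ι : Type*} [Fintype V] [Fintype ι] {G : SimpleGraph V} {l : ℝ}
    (hl : ∀ x : V → ℝ, quad G x ≤ l * ∑ u, x u ^ 2) {f : ι → V}
    (hf : Function.Injective f) (x : ι → ℝ) :
    ∑ i, ∑ j, adjInd G (f i) (f j) * (x i * x j) ≤ l * ∑ i, x i ^ 2 := by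
  rw [← quad_extend G hf, ← sum_sq_extend hf]
  exact hl _

lemma quad_eq_of_eigen {V : Type*} [Fintype V] {G : SimpleGraph V} {l : ℝ} {z : V → ℝ}
    (heig : ∀ u, ∑ v, adjInd G u v * z v = l * z u) : quad G z = l * ∑ u, z u ^ 2 := by
  rw [quad, mul_sum]
  refine sum_congr rfl fun u _ => ?_
  calc ∑ v, adjInd G u v * (z u * z v) = z u * ∑ v, adjInd G u v * z v := by
        rw [mul_sum]; exact sum_congr rfl fun v _ => by ring
    _ = l * z u ^ 2 := by rw [heig u]; ring

/-- The spectral radius is monotone along injective homomorphisms. -/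
lemma rho_le_of_injective {V W : Type*} [Fintype V] [Fintype W] [Nonempty V]
    {H : SimpleGraph V} {G : SimpleGraph W} {f : V → W} (hf : Function.Injective f)
    (hom : ∀ u v, H.Adj u v → G.Adj (f u) (f v)) : rho H ≤ rho G := by
  have : Nonempty W := ‹Nonempty V›.map f
  obtain ⟨l, hl0, hl, -, z, hz0, hz, heig⟩ := exists_perron H
  obtain ⟨m, hm0, hm, hR, -⟩ := exists_perron G
  rw [hl, hm]
  refine ENNReal.ofReal_le_ofReal ?_
  have h1 := rayleigh_of_injective hR hf z
  have h2 : quad H z ≤ ∑ i, ∑ j, adjInd G (f i) (f j) * (z i * z j) := by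
    refine sum_le_sum fun i _ => sum_le_sum fun j _ => ?_
    refine mul_le_mul_of_nonneg_right ?_ (mul_nonneg (hz0 i) (hz0 j))
    by_cases h : H.Adj i j
    · rw [adjInd_of_adj h, adjInd_of_adj (hom _ _ h)]
    · rw [adjInd_of_not_adj h]; exact adjInd_nonneg _ _ _
  rw [quad_eq_of_eigen heig] at h2
  have hpos : 0 < ∑ u, z u ^ 2 := by
    obtain ⟨u, hu⟩ := Function.ne_iff.1 hz
    exact sum_pos' (fun _ _ => sq_nonneg _) ⟨u, mem_univ u, by have : z u ≠ 0 := hu; positivity⟩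
  exact le_of_mul_le_mul_right (h2.trans h1) hpos

lemma sum_range_symm (B : ℕ → ℕ → ℝ) (hB : ∀ i j, B i j = B j i) (h0 : ∀ i, B i i = 0) (m : ℕ) :
    ∑ i ∈ range m, ∑ j ∈ range m, B i j = ∑ k ∈ range m, 2 * ∑ i ∈ range k, B k i := by
  induction m with
  | zero => simp
  | succ m ih =>
    simp only [sum_range_succ, sum_add_distrib, ih, h0]
    rw [sum_congr rfl fun i _ => hB i m]; ring

/-- The Rayleigh bound for vertices `f 0, …, f (m - 1)`, where `F k` collects some of the
neighbours of `f k` among the earlier vertices. -/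
lemma rayleigh_of_injOn {V : Type*} [Fintype V] {G : SimpleGraph V} {l : ℝ}
    (hl : ∀ x : V → ℝ, quad G x ≤ l * ∑ u, x u ^ 2) {f : ℕ → V} {m : ℕ}
    (hf : Set.InjOn f (Set.Iio m)) (F : ℕ → Finset ℕ)
    (hF : ∀ k < m, ∀ i ∈ F k, i < k ∧ G.Adj (f k) (f i)) {x : ℕ → ℝ} (hx : ∀ i, 0 ≤ x i) :
    ∑ k ∈ range m, 2 * (x k * ∑ i ∈ F k, x i) ≤ l * ∑ k ∈ range m, x k ^ 2 := by
  have hinj : Function.Injective fun i : Fin m => f i := fun i j h =>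
    Fin.ext (hf i.2 j.2 h)
  have h1 := rayleigh_of_injective hl hinj fun i : Fin m => x i
  rw [← sum_range fun i => x i ^ 2] at h1
  refine le_trans ?_ h1
  have h2 : ∑ i : Fin m, ∑ j : Fin m, adjInd G (f i) (f j) * (x i * x j)
      = ∑ i ∈ range m, ∑ j ∈ range m, adjInd G (f i) (f j) * (x i * x j) := by
    rw [sum_range]
    exact sum_congr rfl fun i _ =>
      (sum_range fun j => adjInd G (f i) (f j) * (x i * x j)).symm
  rw [h2, sum_range_symm (fun i j => adjInd G (f i) (f j) * (x i * x j))
    (fun i j => by rw [adjInd_comm, mul_comm (x i)]) (fun i => by rw [adjInd_self, zero_mul])]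
  refine sum_le_sum fun k hk => ?_
  refine mul_le_mul_of_nonneg_left ?_ zero_le_two
  rw [mul_sum]
  calc ∑ i ∈ F k, x k * x i = ∑ i ∈ F k, adjInd G (f k) (f i) * (x k * x i) :=
        sum_congr rfl fun i hi => by
          rw [adjInd_of_adj (hF k (mem_range.1 hk) i hi).2, one_mul]
    _ ≤ ∑ i ∈ range k, adjInd G (f k) (f i) * (x k * x i) :=
        sum_le_sum_of_subset_of_nonneg
          (fun i hi => mem_range.2 (hF k (mem_range.1 hk) i hi).1)
          fun i _ _ => mul_nonneg (adjInd_nonneg _ _ _) (mul_nonneg (hx _) (hx _))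

/-! ### Adjacency in the square of a graph. -/

section square
variable {V : Type*} {G : SimpleGraph V} {u v w : V}

lemma sq_adj_iff : (graphPower G 2).Adj u v ↔
    u ≠ v ∧ (G.Adj u v ∨ ∃ w, G.Adj u w ∧ G.Adj w v) := by
  show (u ≠ v ∧ G.edist u v ≤ (2 : ℕ)) ↔ _
  refine and_congr_right fun huv => ⟨fun h => ?_, fun h => ?_⟩
  · obtain ⟨p, hp⟩ := SimpleGraph.exists_walk_of_edist_ne_top
      (ne_top_of_le_ne_top (ENat.natCast_ne_top 2) h)
    rw [← hp] at h
    have hlen : p.length ≤ 2 := by exact_mod_cast h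
    match p, hlen with
    | .nil, _ => exact absurd rfl huv
    | .cons h1 .nil, _ => exact Or.inl h1
    | .cons h1 (.cons h2 .nil), _ => exact Or.inr ⟨_, h1, h2⟩
    | .cons _ (.cons _ (.cons _ _)), hlen => simp at hlen
  · rcases h with h | ⟨w, h1, h2⟩
    · exact (SimpleGraph.Walk.edist_le h.toWalk).trans (by simp)
    · exact (SimpleGraph.Walk.edist_le (.cons h1 (.cons h2 .nil))).trans (by simp)

lemma sq_adj_of_adj (h : G.Adj u v) : (graphPower G 2).Adj u v :=
  sq_adj_iff.2 ⟨h.ne, Or.inl h⟩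

lemma sq_adj_of_common (h₁ : G.Adj u w) (h₂ : G.Adj w v) (h : u ≠ v) :
    (graphPower G 2).Adj u v :=
  sq_adj_iff.2 ⟨h, Or.inr ⟨w, h₁, h₂⟩⟩

lemma sq_hom {W : Type*} {H : SimpleGraph W} {f : V → W} (hf : Function.Injective f)
    (hom : ∀ a b, G.Adj a b → H.Adj (f a) (f b)) (a b : V) (h : (graphPower G 2).Adj a b) :
    (graphPower H 2).Adj (f a) (f b) := by
  obtain ⟨hne, h | ⟨c, h1, h2⟩⟩ := sq_adj_iff.1 h
  · exact sq_adj_of_adj (hom _ _ h)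
  · exact sq_adj_of_common (hom _ _ h1) (hom _ _ h2) (hf.ne hne)

lemma rhoSq_congr {W : Type*} {H : SimpleGraph W} [Fintype V] [Fintype W] [Nonempty V]
    (e : G ≃g H) : rhoSq G = rhoSq H :=
  haveI : Nonempty W := ‹Nonempty V›.map e
  le_antisymm
    (rho_le_of_injective e.injective (sq_hom e.injective fun _ _ h => e.map_adj_iff.2 h))
    (rho_le_of_injective e.symm.injective
      (sq_hom e.symm.injective fun _ _ h => e.symm.map_adj_iff.2 h))

lemma sq_preconnected (h : G.Preconnected) : (graphPower G 2).Preconnected :=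
  h.mono fun _ _ => sq_adj_of_adj

end square

/-! ### Copies of rooted trees and their extension by one vertex. -/

/-- The vertices `f 0, …, f (m - 1)` of `U` form a copy of the rooted tree on `0, …, m - 1` in
which `par k` is the parent of `k > 0`. -/
def IsCopy {V : Type*} (U : SimpleGraph V) (m : ℕ) (par : ℕ → ℕ) (f : ℕ → V) : Prop :=
  Set.InjOn f (Set.Iio m) ∧ ∀ k, 0 < k → k < m → U.Adj (f (par k)) (f k)

/-- `U` contains the rooted tree on `0, …, m - 1` with parent function `par`. -/
def HasCopy {V : Type*} (U : SimpleGraph V) (m : ℕ) (par : ℕ → ℕ) : Prop :=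
  ∃ f, IsCopy U m par f

/-- The parent function of the path `0, …, L` with further vertices `L + 1`, `L + 2`, `L + 3`
attached to `c`, `c'`, `c''`. -/
def catPar (L c c' c'' k : ℕ) : ℕ :=
  if k ≤ L then k - 1 else if k = L + 1 then c else if k = L + 2 then c' else c''

/-- Adjacency of `a` and `b` in the rooted tree with parent function `par`. -/
def ParAdj (par : ℕ → ℕ) (a b : ℕ) : Prop := (b ≠ 0 ∧ par b = a) ∨ (a ≠ 0 ∧ par a = b)

section copy
variable {V : Type*} {U : SimpleGraph V} {m : ℕ} {par : ℕ → ℕ}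

lemma IsCopy.adj {f : ℕ → V} (h : IsCopy U m par f) {a b : ℕ} (ha : a < m) (hb : b < m)
    (hab : ParAdj par a b) : U.Adj (f a) (f b) := by
  rcases hab with ⟨h0, rfl⟩ | ⟨h0, rfl⟩
  · exact h.2 b (Nat.pos_of_ne_zero h0) hb
  · exact (h.2 a (Nat.pos_of_ne_zero h0) ha).symm

lemma IsCopy.comp {f : ℕ → V} (h : IsCopy U m par f) {m' : ℕ} {par' : ℕ → ℕ} (g : ℕ → ℕ)
    (hlt : ∀ k < m', g k < m) (hinj : ∀ a b, a < b → b < m' → g a ≠ g b)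
    (hpar : ∀ k, 0 < k → k < m' → par' k < k)
    (hadj : ∀ k, 0 < k → k < m' → ParAdj par (g (par' k)) (g k)) :
    IsCopy U m' par' (f ∘ g) := by
  refine ⟨fun a ha b hb hab => ?_, fun k h0 hk => ?_⟩
  · have := h.1 (hlt a ha) (hlt b hb) hab
    rcases lt_trichotomy a b with h' | h' | h'
    · exact absurd this (hinj a b h' hb)
    · exact h'
    · exact absurd this.symm (hinj b a h' ha)
  · exact h.adj (hlt _ ((hpar k h0 hk).trans hk)) (hlt k hk) (hadj k h0 hk)

/-- Containment of trees is transitive: `g` places the smaller tree in the larger one. The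
conditions are stated for ordered pairs and parents only, which keeps them checkable by evaluation
or case analysis. -/
lemma HasCopy.embed (h : HasCopy U m par) {m' : ℕ} {par' : ℕ → ℕ} (g : ℕ → ℕ)
    (hlt : ∀ k < m', g k < m) (hinj : ∀ a b, a < b → b < m' → g a ≠ g b)
    (hpar : ∀ k, 0 < k → k < m' → par' k < k)
    (hadj : ∀ k, 0 < k → k < m' → ParAdj par (g (par' k)) (g k)) : HasCopy U m' par' := by
  obtain ⟨f, hf⟩ := h
  exact ⟨_, hf.comp g hlt hinj hpar hadj⟩

/-- In a connected graph some vertex outside a smaller family is adjacent to a member. -/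
lemma exists_adj_of_lt_card [Fintype V] (hU : U.Preconnected) (f : ℕ → V)
    (hm : 0 < m) (hlt : m < Fintype.card V) :
    ∃ i < m, ∃ w, (∀ j < m, f j ≠ w) ∧ U.Adj (f i) w := by
  classical
  by_contra hcon
  push Not at hcon
  have walk : ∀ {a b} (_ : U.Walk a b), (∃ i < m, f i = a) → ∃ i < m, f i = b := by
    intro a b p
    induction p with
    | nil => exact id
    | cons hadj _ ih =>
      rintro ⟨i, hi, rfl⟩
      refine ih ?_
      by_contra hno
      push Not at hno
      exact hcon i hi _ hno hadj
  have hsurj : (univ : Finset V) ⊆ (range m).image f := by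
    intro v _
    obtain ⟨p⟩ := hU (f 0) v
    obtain ⟨i, hi, rfl⟩ := walk p ⟨0, hm, rfl⟩
    exact mem_image_of_mem f (mem_range.2 hi)
  have := (card_le_card hsurj).trans card_image_le
  rw [card_range, card_univ] at this
  omega

lemma IsCopy.update {f : ℕ → V} (h : IsCopy U m par f) {par' : ℕ → ℕ} {w : V}
    (hw : ∀ j < m, f j ≠ w) (hpar : ∀ k, 0 < k → k < m → par' k = par k ∧ par k < m)
    (hi : par' m < m) (hadj : U.Adj (f (par' m)) w) :
    HasCopy U (m + 1) par' := by
  refine ⟨Function.update f m w, fun a ha b hb hab => ?_, fun k h0 hk => ?_⟩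
  · have ha : a < m + 1 := ha
    have hb : b < m + 1 := hb
    rcases (Nat.lt_succ_iff_lt_or_eq.1 ha) with ha | rfl <;>
      rcases (Nat.lt_succ_iff_lt_or_eq.1 hb) with hb | rfl
    · rw [Function.update_of_ne ha.ne, Function.update_of_ne hb.ne] at hab
      exact h.1 ha hb hab
    · rw [Function.update_of_ne ha.ne, Function.update_self] at hab
      exact absurd hab (hw a ha)
    · rw [Function.update_of_ne hb.ne, Function.update_self] at hab
      exact absurd hab.symm (hw b hb)
    · rfl
  · rcases (Nat.lt_succ_iff_lt_or_eq.1 hk) with hk | rfl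
    · rw [Function.update_of_ne hk.ne, (hpar k h0 hk).1,
        Function.update_of_ne (hpar k h0 hk).2.ne]
      exact h.2 k h0 hk
    · rwa [Function.update_self, Function.update_of_ne hi.ne]

/-- The arguments of `catPar` for vertices not yet present are never read; here the dummy `a` gives
way to the actual point of attachment. -/
lemma HasCopy.extend_one [Fintype V] (hU : U.Preconnected) {L c a b : ℕ} (hc : c ≤ L)
    (h : HasCopy U (L + 2) (catPar L c a b)) (hlt : L + 2 < Fintype.card V) :
    ∃ i < L + 2, HasCopy U (L + 3) (catPar L c i b) := by
  obtain ⟨f, hf⟩ := h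
  obtain ⟨i, hi, w, hw, hadj⟩ := exists_adj_of_lt_card hU f (by omega) hlt
  have hi' : catPar L c i b (L + 2) = i := by simp [catPar]
  refine ⟨i, hi, hf.update hw (fun k h0 hk => ?_) (by rwa [hi']) (by rwa [hi'])⟩
  unfold catPar; split_ifs <;> omega

lemma HasCopy.extend_two [Fintype V] (hU : U.Preconnected) {L c c' b : ℕ} (hc : c ≤ L)
    (hc' : c' < L + 2)
    (h : HasCopy U (L + 3) (catPar L c c' b)) (hlt : L + 3 < Fintype.card V) :
    ∃ i < L + 3, HasCopy U (L + 4) (catPar L c c' i) := by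
  obtain ⟨f, hf⟩ := h
  obtain ⟨i, hi, w, hw, hadj⟩ := exists_adj_of_lt_card hU f (by omega) hlt
  have hi' : catPar L c c' i (L + 3) = i := by simp [catPar]
  refine ⟨i, hi, hf.update hw (fun k h0 hk => ?_) (by rwa [hi']) (by rwa [hi'])⟩
  unfold catPar; split_ifs <;> omega

end copy

/-! ### Lower bounds for particular trees from integer test vectors. -/

section lower
variable {V : Type*} [Fintype V] {U : SimpleGraph V} {m : ℕ} {par : ℕ → ℕ} {l : ℝ}

/-- A lower bound for the Rayleigh constant of the square from natural weights on a copy. -/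
lemma HasCopy.le_of_weights
    (hl : ∀ x : V → ℝ, quad (graphPower U 2) x ≤ l * ∑ u, x u ^ 2) (h : HasCopy U m par)
    (F : ℕ → Finset ℕ)
    (hF : ∀ k < m, ∀ i ∈ F k, i < k ∧ par k < k ∧ (i = par k ∨ (par k ≠ 0 ∧ i = par (par k)) ∨
      (i ≠ 0 ∧ par i = par k)))
    (x : ℕ → ℕ) {a b : ℕ} (hx : 0 < ∑ k ∈ range m, x k ^ 2)
    (hab : a * ∑ k ∈ range m, x k ^ 2 ≤ b * ∑ k ∈ range m, 2 * (x k * ∑ i ∈ F k, x i)) :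
    (a : ℝ) ≤ b * l := by
  obtain ⟨f, hf⟩ := h
  have h1 := rayleigh_of_injOn hl hf.1 F (fun k hk i hi => by
    obtain ⟨hik, hpk, h⟩ := hF k hk i hi
    have hk0 : 0 < k := by omega
    have hne : f k ≠ f i := fun h => by
      have := hf.1 (show k < m from hk) (show i < m from hik.trans hk) h
      omega
    refine ⟨hik, ?_⟩
    -- Parent, grandparent or sibling. The value `par 0` carries no meaning, hence the side
    -- conditions `h0`.
    rcases h with rfl | ⟨h0, rfl⟩ | ⟨h0, h⟩
    · exact sq_adj_of_adj (hf.2 k hk0 hk).symm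
    · exact sq_adj_of_common (hf.2 k hk0 hk).symm
        (hf.2 _ (Nat.pos_of_ne_zero h0) (hpk.trans hk)).symm hne
    · refine sq_adj_of_common (hf.2 k hk0 hk).symm ?_ hne
      rw [← h]
      exact hf.2 i (Nat.pos_of_ne_zero h0) (hik.trans hk)) (x := fun k => (x k : ℝ))
      (fun i => Nat.cast_nonneg _)
  have h2 : (a : ℝ) * ∑ k ∈ range m, (x k : ℝ) ^ 2
      ≤ b * ∑ k ∈ range m, 2 * ((x k : ℝ) * ∑ i ∈ F k, (x i : ℝ)) := by exact_mod_cast hab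
  have h3 : (0 : ℝ) < ∑ k ∈ range m, (x k : ℝ) ^ 2 := by exact_mod_cast hx
  refine le_of_mul_le_mul_right ?_ h3
  calc _ ≤ _ := h2
    _ ≤ b * (l * ∑ k ∈ range m, (x k : ℝ) ^ 2) := by gcongr
    _ = _ := by ring

/-- The earlier neighbours of `k` in the square of the tree with parent function `par`. -/
def earlier (par : ℕ → ℕ) (k : ℕ) : Finset ℕ :=
  (range k).filter fun i => par k < k ∧
    (i = par k ∨ (par k ≠ 0 ∧ i = par (par k)) ∨ (i ≠ 0 ∧ par i = par k))

lemma HasCopy.le_of_list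
    (hl : ∀ x : V → ℝ, quad (graphPower U 2) x ≤ l * ∑ u, x u ^ 2) (h : HasCopy U m par)
    (x : ℕ → ℕ) (a b : ℕ)
    (hab : 0 < ∑ k ∈ range m, x k ^ 2 ∧
      a * ∑ k ∈ range m, x k ^ 2 ≤ b * ∑ k ∈ range m, 2 * (x k * ∑ i ∈ earlier par k, x i)) :
    (a : ℝ) ≤ b * l :=
  h.le_of_weights hl (earlier par)
    (fun k _ i hi => by simpa [earlier, mem_filter, and_assoc] using hi) x hab.1 hab.2

/-- The square of a star with four leaves is complete on five vertices. -/
lemma four_le_of_star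
    (hl : ∀ x : V → ℝ, quad (graphPower U 2) x ≤ l * ∑ u, x u ^ 2)
    (h : HasCopy U 5 (catPar 2 1 1 0)) : 4 ≤ l := by
  have := h.le_of_list hl (fun _ => 1) 4 1 (by decide +kernel)
  push_cast at this; linarith

/-- From here on the names list the arm lengths at the only branch vertex (in this case 1, 3, 6, the
pendant arm being left out). The list gives the test weights of the vertices in order. -/
lemma four_le_of_three_six
    (hl : ∀ x : V → ℝ, quad (graphPower U 2) x ≤ l * ∑ u, x u ^ 2)
    (h : HasCopy U 11 (catPar 9 3 0 0)) : 4 ≤ l := by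
  have := h.le_of_list hl (fun k => [2, 3, 5, 5, 5, 4, 3, 2, 2, 1, 4].getD k 0) 4 1
    (by decide +kernel)
  push_cast at this; linarith

lemma four_le_of_four_four
    (hl : ∀ x : V → ℝ, quad (graphPower U 2) x ≤ l * ∑ u, x u ^ 2)
    (h : HasCopy U 10 (catPar 8 4 0 0)) : 4 ≤ l := by
  have := h.le_of_list hl (fun k => [1, 2, 3, 4, 4, 4, 3, 2, 1, 3].getD k 0) 4 1
    (by decide +kernel)
  push_cast at this; linarith

lemma four_le_of_two_two_four
    (hl : ∀ x : V → ℝ, quad (graphPower U 2) x ≤ l * ∑ u, x u ^ 2)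
    (h : HasCopy U 9 (catPar 6 2 7 0)) : 4 ≤ l := by
  have := h.le_of_list hl (fun k => [2, 3, 4, 4, 3, 2, 1, 3, 2].getD k 0) 4 1
    (by decide +kernel)
  push_cast at this; linarith

lemma four_le_of_two_three_three
    (hl : ∀ x : V → ℝ, quad (graphPower U 2) x ≤ l * ∑ u, x u ^ 2)
    (h : HasCopy U 9 (catPar 6 3 7 0)) : 4 ≤ l := by
  have := h.le_of_list hl (fun k => [1, 1, 2, 2, 2, 1, 1, 2, 1].getD k 0) 4 1
    (by decide +kernel)
  push_cast at this; linarith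

/-- This bound and the next two lie just above the upper bounds 3.56, 3.8 and 3.85 for lollipops of
order at most 6, 8 and 10. -/
lemma le_of_one_two_two
    (hl : ∀ x : V → ℝ, quad (graphPower U 2) x ≤ l * ∑ u, x u ^ 2)
    (h : HasCopy U 6 (catPar 4 2 0 0)) : 3.58 ≤ l := by
  have := h.le_of_list hl (fun k => [3, 5, 6, 5, 3, 5].getD k 0) 358 100 (by decide +kernel)
  push_cast at this; linarith

lemma le_of_two_two_two
    (hl : ∀ x : V → ℝ, quad (graphPower U 2) x ≤ l * ∑ u, x u ^ 2)
    (h : HasCopy U 7 (catPar 4 2 5 0)) : 3.82 ≤ l := by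
  have := h.le_of_list hl (fun k => [3, 5, 6, 5, 3, 5, 3].getD k 0) 382 100 (by decide +kernel)
  push_cast at this; linarith

lemma le_of_one_three_three
    (hl : ∀ x : V → ℝ, quad (graphPower U 2) x ≤ l * ∑ u, x u ^ 2)
    (h : HasCopy U 8 (catPar 6 3 0 0)) : 3.87 ≤ l := by
  have := h.le_of_list hl (fun k => [2, 3, 5, 5, 5, 3, 2, 4].getD k 0) 387 100 (by decide +kernel)
  push_cast at this; linarith

/-- Meant for the lollipop itself: 3.65 exceeds `1 + √7`, the threshold in
`IsLolliPerron.lt_entry_four`. -/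
lemma le_of_fork_seven
    (hl : ∀ x : V → ℝ, quad (graphPower U 2) x ≤ l * ∑ u, x u ^ 2)
    (h : HasCopy U 7 (catPar 5 1 0 0)) : 3.65 ≤ l := by
  have := h.le_of_list hl (fun k => [7, 9, 10, 8, 6, 4, 7].getD k 0) 365 100 (by decide +kernel)
  push_cast at this; linarith

end lower
-- Lower bounds for families with several branch vertices.
section families
variable {V : Type*} [Fintype V] {U : SimpleGraph V} {l : ℝ}

/-- Earlier neighbours in the square of a path with pendant vertices attached to inner vertices. -/
def catEarlier (L c c' c'' k : ℕ) : Finset ℕ :=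
  if k = 0 then ∅ else if k = 1 then {0} else if k ≤ L then {k - 2, k - 1}
  else if k = L + 1 then {c - 1, c, c + 1}
  else if k = L + 2 then {c' - 1, c', c' + 1} else {c'' - 1, c'', c'' + 1}

/-- The alternatives `m ≤ L + 2` and `m ≤ L + 3` cover copies in which the second or third pendant
vertex is absent. -/
lemma catEarlier_spec {L c c' c'' m : ℕ} (hc : 0 < c ∧ c < L) (hc' : m ≤ L + 2 ∨ 0 < c' ∧ c' < L)
    (hc'' : m ≤ L + 3 ∨ 0 < c'' ∧ c'' < L) (hm : m ≤ L + 4) (k : ℕ) (hk : k < m) (i : ℕ)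
    (hi : i ∈ catEarlier L c c' c'' k) :
    i < k ∧ catPar L c c' c'' k < k ∧ (i = catPar L c c' c'' k ∨
      (catPar L c c' c'' k ≠ 0 ∧ i = catPar L c c' c'' (catPar L c c' c'' k)) ∨
      (i ≠ 0 ∧ catPar L c c' c'' i = catPar L c c' c'' k)) := by
  unfold catEarlier at hi
  split_ifs at hi with h0 h1 h2 h3 h4
  · simp at hi
  · simp only [mem_singleton] at hi
    subst hi h1
    simp [catPar, show 1 ≤ L by omega]
  · simp only [mem_insert, mem_singleton] at hi
    have e1 : catPar L c c' c'' k = k - 1 := by simp [catPar, h2]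
    have e2 : catPar L c c' c'' (k - 1) = k - 2 := by
      rw [catPar, if_pos (by omega)]; omega
    rw [e1, e2]; omega
  · simp only [mem_insert, mem_singleton] at hi
    have e1 : catPar L c c' c'' k = c := by simp [catPar, h3]
    have e2 : catPar L c c' c'' c = c - 1 := by
      rw [catPar, if_pos (by omega)]
    have e3 : catPar L c c' c'' (c + 1) = c := by
      rw [catPar, if_pos (by omega), Nat.add_sub_cancel]
    rw [e1, e2]
    rcases hi with rfl | rfl | rfl
    · omega
    · omega
    · rw [e3]; omega
  · have hc1 : 0 < c' ∧ c' < L := by omega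
    simp only [mem_insert, mem_singleton] at hi
    have e1 : catPar L c c' c'' k = c' := by simp [catPar, h4]
    have e2 : catPar L c c' c'' c' = c' - 1 := by
      rw [catPar, if_pos (by omega)]
    have e3 : catPar L c c' c'' (c' + 1) = c' := by
      rw [catPar, if_pos (by omega), Nat.add_sub_cancel]
    rw [e1, e2]
    rcases hi with rfl | rfl | rfl
    · omega
    · omega
    · rw [e3]; omega
  · have hc1 : 0 < c'' ∧ c'' < L := by omega
    simp only [mem_insert, mem_singleton] at hi
    have e1 : catPar L c c' c'' k = c'' := by simp [catPar, h2, h3, h4]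
    have e2 : catPar L c c' c'' c'' = c'' - 1 := by
      rw [catPar, if_pos (by omega)]
    have e3 : catPar L c c' c'' (c'' + 1) = c'' := by
      rw [catPar, if_pos (by omega), Nat.add_sub_cancel]
    rw [e1, e2]
    rcases hi with rfl | rfl | rfl
    · omega
    · omega
    · rw [e3]; omega

/-- Test weights for two branch vertices at distance `s` with arms `1, 1` and `1, 2`. -/
def branchWeight (s k : ℕ) : ℕ :=
  if k = 0 then 4 else if k = 1 then 5 else if k ≤ s + 2 then 6 else if k = s + 3 then 3
  else if k = s + 4 then 4 else 5

/-- Two branch vertices at distance `s` with arms `1, 1` and `1, 2`. -/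
lemma four_le_of_two_branches (hl : ∀ x : V → ℝ, quad (graphPower U 2) x ≤ l * ∑ u, x u ^ 2)
    {s : ℕ} (hs : 1 ≤ s) (h : HasCopy U (s + 6) (catPar (s + 3) 1 (s + 1) 0)) : 4 ≤ l := by
  -- For `s = 1` the general weights fall short: the pendant vertex of the second branch vertex sees
  -- a 5 in place of a 6.
  rcases hs.eq_or_lt with rfl | hs
  · have := h.le_of_list hl (fun k => [2, 3, 3, 2, 1, 2, 2].getD k 0) 4 1 (by decide +kernel)
    push_cast at this; linarith
  obtain ⟨t, rfl⟩ : ∃ t, s = t + 2 := ⟨s - 2, by omega⟩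
  have w6 : ∀ j, 2 ≤ j → j ≤ t + 4 → branchWeight (t + 2) j = 6 := fun j h1 h2 => by
    simp [branchWeight, show j ≠ 0 by omega, show j ≠ 1 by omega, h2]
  have w0 : branchWeight (t + 2) 0 = 4 := rfl
  have w1 : branchWeight (t + 2) 1 = 5 := rfl
  have wa : branchWeight (t + 2) (t + 5) = 3 := by simp [branchWeight]
  have wb : branchWeight (t + 2) (t + 6) = 4 := by simp [branchWeight]
  have wc : branchWeight (t + 2) (t + 7) = 5 := by simp [branchWeight]
  have hN : ∑ j ∈ range (t + 8), branchWeight (t + 2) j ^ 2 = 36 * t + 199 := by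
    rw [sum_range_succ, sum_range_succ, sum_range_succ, sum_range_succ', sum_range_succ',
      sum_congr rfl (g := fun _ => 36) fun j hj => by
        have := mem_range.1 hj
        rw [w6 _ (by omega) (by omega)]; norm_num]
    simp only [zero_add, w0, w1, wa, wb, wc, sum_const, card_range, smul_eq_mul]
    ring
  -- This is exactly four times the squared norm in `hN`.
  have hQ : ∑ j ∈ range (t + 8), 2 * (branchWeight (t + 2) j *
      ∑ i ∈ catEarlier (t + 5) 1 (t + 3) 0 j, branchWeight (t + 2) i) = 144 * t + 796 := by
    have hp : ∀ j, 2 ≤ j → j ≤ t + 5 → ∑ i ∈ catEarlier (t + 5) 1 (t + 3) 0 j,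
        branchWeight (t + 2) i = branchWeight (t + 2) (j - 2) + branchWeight (t + 2) (j - 1) := by
      intro j h1 h2
      simp only [catEarlier, show j ≠ 0 by omega, show j ≠ 1 by omega, h2, if_true, if_false]
      rw [sum_pair (by omega)]
    have s0 : ∑ i ∈ catEarlier (t + 5) 1 (t + 3) 0 0, branchWeight (t + 2) i = 0 := by
      simp [catEarlier]
    have s1 : ∑ i ∈ catEarlier (t + 5) 1 (t + 3) 0 1, branchWeight (t + 2) i = 4 := by
      simp [catEarlier, w0]
    have s2 : ∑ i ∈ catEarlier (t + 5) 1 (t + 3) 0 2, branchWeight (t + 2) i = 9 := by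
      rw [hp 2 (by omega) (by omega), w0, w1]
    have s3 : ∑ i ∈ catEarlier (t + 5) 1 (t + 3) 0 3, branchWeight (t + 2) i = 11 := by
      rw [hp 3 (by omega) (by omega), w1, w6 _ (by omega) (by omega)]
    have sa : ∑ i ∈ catEarlier (t + 5) 1 (t + 3) 0 (t + 5), branchWeight (t + 2) i = 12 := by
      rw [hp _ (by omega) (by omega), w6 _ (by omega) (by omega), w6 _ (by omega) (by omega)]
    have sb : ∑ i ∈ catEarlier (t + 5) 1 (t + 3) 0 (t + 6), branchWeight (t + 2) i = 15 := by
      have : catEarlier (t + 5) 1 (t + 3) 0 (t + 6) = {0, 1, 2} := by simp [catEarlier]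
      rw [this, sum_insert (by simp), sum_pair (by simp), w0, w1, w6 _ (by omega) (by omega)]
      norm_num
    have sc : ∑ i ∈ catEarlier (t + 5) 1 (t + 3) 0 (t + 7), branchWeight (t + 2) i = 18 := by
      have : catEarlier (t + 5) 1 (t + 3) 0 (t + 7) = {t + 2, t + 3, t + 4} := by
        simp [catEarlier]
      rw [this, sum_insert (by simp), sum_pair (by simp), w6 _ (by omega) (by omega),
        w6 _ (by omega) (by omega), w6 _ (by omega) (by omega)]
      norm_num
    rw [sum_range_succ, sum_range_succ, sum_range_succ, sum_range_succ', sum_range_succ',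
      sum_range_succ', sum_range_succ', sum_congr rfl (g := fun _ => 144) fun j hj => by
        have := mem_range.1 hj
        rw [hp _ (by omega) (by omega), w6 _ (by omega) (by omega), w6 _ (by omega) (by omega),
          w6 _ (by omega) (by omega)]]
    simp only [zero_add, Nat.reduceAdd, s0, s1, s2, s3, sa, sb, sc, w0, w1, wa, wb, wc,
      w6 2 (by omega) (by omega), w6 3 (by omega) (by omega), sum_const, card_range, smul_eq_mul]
    ring
  have := h.le_of_weights hl (catEarlier (t + 5) 1 (t + 3) 0)
    (catEarlier_spec (by omega) (by omega) (by omega) (by omega)) (branchWeight (t + 2))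
    (a := 4) (b := 1) (by rw [hN]; omega) (by rw [hN, hQ]; omega)
  push_cast at this; linarith

/-- Three branch vertices on a path of length `L` whose other arms are pendant vertices. -/
lemma four_le_of_three_branches (hl : ∀ x : V → ℝ, quad (graphPower U 2) x ≤ l * ∑ u, x u ^ 2)
    {L k : ℕ} (hk : 2 ≤ k) (hkL : k + 2 ≤ L) (h : HasCopy U (L + 4) (catPar L 1 k (L - 1))) :
    4 ≤ l := by
  obtain ⟨t, rfl⟩ : ∃ t, L = t + 2 := ⟨L - 2, by omega⟩
  -- Constant weights suffice: the square has at least `2 * (L + 4)` edges on `L + 4` vertices, so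
  -- its average degree is at least 4.
  have key : ∑ j ∈ range (t + 6), 2 * (1 * ∑ i ∈ catEarlier (t + 2) 1 k (t + 1) j, 1)
      = 4 * (t + 6) := by
    have hmid : ∀ j ∈ range (t + 1), 2 * (1 * ∑ i ∈ catEarlier (t + 2) 1 k (t + 1) (j + 2), 1)
        = 4 := by
      intro j hj
      have := mem_range.1 hj
      simp only [catEarlier, show j + 2 ≠ 0 by omega, show j + 2 ≠ 1 by omega,
        show j + 2 ≤ t + 2 by omega, if_true, if_false]
      rw [sum_pair (by omega)]; norm_num
    rw [sum_range_succ, sum_range_succ, sum_range_succ, sum_range_succ', sum_range_succ',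
      sum_congr rfl hmid]
    have e1 : catEarlier (t + 2) 1 k (t + 1) (t + 3) = {0, 1, 2} := by simp [catEarlier]
    have e2 : catEarlier (t + 2) 1 k (t + 1) (t + 4) = {k - 1, k, k + 1} := by simp [catEarlier]
    have e3 : catEarlier (t + 2) 1 k (t + 1) (t + 5) = {t, t + 1, t + 2} := by simp [catEarlier]
    rw [e1, e2, e3]
    have c1 : #({k - 1, k, k + 1} : Finset ℕ) = 3 := card_eq_three.2
      ⟨_, _, _, by omega, by omega, by omega, rfl⟩
    have c2 : #({t, t + 1, t + 2} : Finset ℕ) = 3 := card_eq_three.2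
      ⟨_, _, _, by omega, by omega, by omega, rfl⟩
    simp [catEarlier, c1, c2]
    omega
  have := h.le_of_weights hl (catEarlier (t + 2) 1 k (t + 1))
    (catEarlier_spec (by omega) (by omega) (by omega) (by omega)) (fun _ => 1) (a := 4) (b := 1)
    (by simp) (by rw [one_mul, key]; simp)
  push_cast at this; linarith

end families
-- Growing a spanning tree while the bound 4 is not reached.
instance (par : ℕ → ℕ) (a b : ℕ) : Decidable (ParAdj par a b) := by
  unfold ParAdj; infer_instance

section growth
variable {V : Type*} {U : SimpleGraph V}

lemma HasCopy.embed_list {m : ℕ} {par : ℕ → ℕ} (h : HasCopy U m par) {m' : ℕ} {par' : ℕ → ℕ}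
    (g : List ℕ) (hg : ∀ k < m', g.getD k 0 < m ∧ (∀ a < k, g.getD a 0 ≠ g.getD k 0) ∧
      (0 < k → par' k < k ∧ ParAdj par (g.getD (par' k) 0) (g.getD k 0))) : HasCopy U m' par' :=
  h.embed (fun k => g.getD k 0) (fun k hk => (hg k hk).1) (fun a b hab hb => (hg b hb).2.1 a hab)
    (fun k h0 hk => ((hg k hk).2.2 h0).1) fun k h0 hk => ((hg k hk).2.2 h0).2

/-- The trees that may occur as spanning trees on `m` vertices when the spectral radius of the
square is less than `4`. -/
def LowCopy (U : SimpleGraph V) (m : ℕ) : Prop :=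
  (∃ L, 2 ≤ L ∧ m = L + 2 ∧ HasCopy U m (catPar L 1 0 0)) ∨
  (∃ L, 3 ≤ L ∧ m = L + 3 ∧ HasCopy U m (catPar L 1 (L - 1) 0)) ∨
  (∃ L, 4 ≤ L ∧ m = L + 2 ∧ HasCopy U m (catPar L 2 0 0)) ∨
  (∃ L, 6 ≤ L ∧ L ≤ 8 ∧ m = L + 2 ∧ HasCopy U m (catPar L 3 0 0)) ∨
  (m = 7 ∧ HasCopy U 7 (catPar 4 2 5 0)) ∨ (m = 8 ∧ HasCopy U 8 (catPar 5 2 6 0))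

variable [Fintype V] {l : ℝ}

/-- The new vertex hangs at `x`. A short leaf gives arms 1, 2, `L - 1`, the branch vertex a star
with four leaves, an inner vertex a second branch vertex, `L - 1` a double fork, and `L` a longer
fork. -/
lemma lowCopy_of_fork (hl : ∀ x : V → ℝ, quad (graphPower U 2) x ≤ l * ∑ u, x u ^ 2)
    (h4 : l < 4) {L x : ℕ} (hL : 2 ≤ L) (hx : x < L + 2) (h : HasCopy U (L + 3) (catPar L 1 x 0)) :
    LowCopy U (L + 3) := by
  -- For `L = 2` the tree is a star whose three leaves are equivalent; the general case distinction
  -- needs a proper long arm.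
  rcases hL.eq_or_lt with rfl | hL
  · have hs : x = 1 ∨ x = 0 ∨ x = 2 ∨ x = 3 := by omega
    rcases hs with rfl | rfl | rfl | rfl
    · exact absurd (four_le_of_star hl h) (not_le.2 h4)
    · exact Or.inl ⟨3, by omega, rfl, h.embed_list [2, 1, 0, 4, 3] (by decide +kernel)⟩
    · exact Or.inl ⟨3, by omega, rfl, h.embed_list [0, 1, 2, 4, 3] (by decide +kernel)⟩
    · exact Or.inl ⟨3, by omega, rfl, h.embed_list [2, 1, 3, 4, 0] (by decide +kernel)⟩
  have hs : x = 0 ∨ x = L + 1 ∨ x = 1 ∨ (2 ≤ x ∧ x + 2 ≤ L) ∨ x = L - 1 ∨ x = L := by omega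
  rcases hs with rfl | rfl | rfl | hx | rfl | rfl
  · refine Or.inr (Or.inr (Or.inl ⟨L + 1, by omega, rfl, h.embed
      (fun k => if k = 0 then L + 2 else if k ≤ L + 1 then k - 1 else L + 1) ?_ ?_ ?_ ?_⟩)) <;>
    grind (splits := 25) [catPar, ParAdj]
  · refine Or.inr (Or.inr (Or.inl ⟨L + 1, by omega, rfl, h.embed
      (fun k => if k = 0 then L + 2 else if k = 1 then L + 1 else if k ≤ L + 1 then k - 1 else 0)
        ?_ ?_ ?_ ?_⟩)) <;>
    grind (splits := 25) [catPar, ParAdj]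
  · refine absurd (four_le_of_star hl (h.embed (fun k => if k ≤ 2 then k else k + L - 2)
      ?_ ?_ ?_ ?_)) (not_le.2 h4) <;>
    grind (splits := 25) [catPar, ParAdj]
  · obtain ⟨s, rfl⟩ : ∃ s, x = s + 1 := ⟨x - 1, by omega⟩
    refine absurd (four_le_of_two_branches hl (s := s) (by omega) (h.embed
      (fun k => if k ≤ s + 3 then k else if k = s + 4 then L + 1 else L + 2)
      ?_ ?_ ?_ ?_)) (not_le.2 h4) <;>
    grind (splits := 25) [catPar, ParAdj]
  · exact Or.inr (Or.inl ⟨L, by omega, rfl, h⟩)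
  · refine Or.inl ⟨x + 1, by omega, rfl, h.embed
      (fun k => if k ≤ x then k else if k = x + 1 then x + 2 else x + 1) ?_ ?_ ?_ ?_⟩ <;>
    grind (splits := 25) [catPar, ParAdj]

/-- Double forks cannot grow: a further vertex creates a star with four leaves, a third branch
vertex, or an arm of length two at one of the two branch vertices. -/
lemma four_le_of_double_fork (hl : ∀ x : V → ℝ, quad (graphPower U 2) x ≤ l * ∑ u, x u ^ 2)
    {L x : ℕ} (hL : 3 ≤ L) (hx : x < L + 3) (h : HasCopy U (L + 4) (catPar L 1 (L - 1) x)) :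
    4 ≤ l := by
  obtain ⟨s, rfl⟩ : ∃ s, L = s + 2 := ⟨L - 2, by omega⟩
  have hs : x = 0 ∨ x = s + 3 ∨ x = 1 ∨ (2 ≤ x ∧ x ≤ s) ∨ x = s + 1 ∨ x = s + 2 ∨ x = s + 4 := by
    omega
  rcases hs with rfl | rfl | rfl | hx | rfl | rfl | rfl
  · refine four_le_of_two_branches hl (s := s) (by omega) (h.embed
      (fun k => if k ≤ s + 2 then s + 2 - k else if k = s + 3 then s + 5 else if k = s + 4 then
        s + 4 else s + 3) ?_ ?_ ?_ ?_) <;>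
    grind (splits := 25) [catPar, ParAdj]
  · refine four_le_of_two_branches hl (s := s) (by omega) (h.embed
      (fun k => if k < s + 2 then s + 2 - k else if k = s + 2 then s + 3 else
        if k = s + 3 then s + 5 else if k = s + 4 then s + 4 else 0) ?_ ?_ ?_ ?_) <;>
    grind (splits := 25) [catPar, ParAdj]
  · refine four_le_of_star hl (h.embed (fun k => if k ≤ 2 then k else if k = 3 then s + 3 else
      s + 5) ?_ ?_ ?_ ?_) <;>
    grind (splits := 25) [catPar, ParAdj]
  · refine four_le_of_three_branches hl (L := s + 2) (k := x) (by omega) (by omega) (h.embed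
      (fun k => if k ≤ s + 3 then k else if k = s + 4 then s + 5 else s + 4) ?_ ?_ ?_ ?_) <;>
    grind (splits := 25) [catPar, ParAdj]
  · refine four_le_of_star hl (h.embed (fun k => if k ≤ 2 then s + 2 - k else if k = 3 then s + 4
      else s + 5) ?_ ?_ ?_ ?_) <;>
    grind (splits := 25) [catPar, ParAdj]
  · refine four_le_of_two_branches hl (s := s) (by omega) (h.embed
      (fun k => if k ≤ s + 2 then k else if k = s + 3 then s + 5 else if k = s + 4 then
        s + 3 else s + 4) ?_ ?_ ?_ ?_) <;>
    grind (splits := 25) [catPar, ParAdj]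
  · refine four_le_of_two_branches hl (s := s) (by omega) (h.embed
      (fun k => if k < s + 2 then k else if k = s + 2 then s + 4 else
        if k = s + 3 then s + 5 else if k = s + 4 then s + 3 else s + 2) ?_ ?_ ?_ ?_) <;>
    grind (splits := 25) [catPar, ParAdj]

/-- With arms 1, `i`, `L - i` the only harmless growth lengthens one arm. Attaching inside an arm
creates a second branch vertex, and as the opposite arm has length at least two,
`four_le_of_two_branches` applies. -/
lemma HasCopy.grow_pendant (hl : ∀ x : V → ℝ, quad (graphPower U 2) x ≤ l * ∑ u, x u ^ 2)
    (h4 : l < 4) {L i x : ℕ} (hi : 2 ≤ i) (hL : i + 2 ≤ L) (hx : x < L + 2)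
    (h : HasCopy U (L + 3) (catPar L i x 0)) :
    HasCopy U (L + 3) (catPar (L + 1) (i + 1) 0 0) ∨ HasCopy U (L + 3) (catPar (L + 1) i 0 0) ∨
      HasCopy U (L + 3) (catPar L i (L + 1) 0) := by
  have hs : x = 0 ∨ x = L ∨ x = L + 1 ∨ x = i ∨ (0 < x ∧ x < i) ∨ (i < x ∧ x < L) := by omega
  rcases hs with rfl | rfl | rfl | rfl | hx | hx
  · refine Or.inl (h.embed (fun k => if k = 0 then L + 2 else if k ≤ L + 1 then k - 1 else L + 1)
      ?_ ?_ ?_ ?_) <;>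
    grind (splits := 25) [catPar, ParAdj]
  · refine Or.inr (Or.inl (h.embed (fun k => if k ≤ x then k else if k = x + 1 then x + 2 else
      x + 1) ?_ ?_ ?_ ?_)) <;>
    grind (splits := 25) [catPar, ParAdj]
  · exact Or.inr (Or.inr h)
  · refine absurd (four_le_of_star hl (h.embed
      (fun k => if k ≤ 2 then x - 1 + k else k + L - 2) ?_ ?_ ?_ ?_)) (not_le.2 h4) <;>
    grind (splits := 25) [catPar, ParAdj]
  · refine absurd (four_le_of_two_branches hl (s := i - x) (by omega) (h.embed
      (fun k => if k ≤ i - x + 3 then x - 1 + k else if k = i - x + 4 then L + 2 else L + 1)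
      ?_ ?_ ?_ ?_)) (not_le.2 h4) <;>
    grind (splits := 25) [catPar, ParAdj]
  · refine absurd (four_le_of_two_branches hl (s := x - i) (by omega) (h.embed
      (fun k => if k ≤ x - i + 3 then x + 1 - k else if k = x - i + 4 then L + 2 else L + 1)
      ?_ ?_ ?_ ?_)) (not_le.2 h4) <;>
    grind (splits := 25) [catPar, ParAdj]

/-- The arms are 1, 2, `L - 2`. Lengthening one of the short arms is possible only while 1, 3, 6 and
2, 2, 4 are avoided. -/
lemma lowCopy_of_one_two (hl : ∀ x : V → ℝ, quad (graphPower U 2) x ≤ l * ∑ u, x u ^ 2)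
    (h4 : l < 4) {L x : ℕ} (hL : 4 ≤ L) (hx : x < L + 2)
    (h : HasCopy U (L + 3) (catPar L 2 x 0)) : LowCopy U (L + 3) := by
  rcases h.grow_pendant hl h4 le_rfl hL hx with h | h | h
  · rcases (by omega : L = 4 ∨ (5 ≤ L ∧ L ≤ 7) ∨ 8 ≤ L) with rfl | hL | hL
    · exact Or.inr (Or.inr (Or.inl ⟨5, by omega, rfl,
        h.embed_list [5, 4, 3, 2, 1, 0, 6] (by decide +kernel)⟩))
    · exact Or.inr (Or.inr (Or.inr (Or.inl ⟨L + 1, by omega, by omega, rfl, h⟩)))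
    · refine absurd (four_le_of_three_six hl (h.embed (fun k => if k ≤ 9 then k else L + 2)
        ?_ ?_ ?_ ?_)) (not_le.2 h4) <;>
      grind (splits := 25) [catPar, ParAdj]
  · exact Or.inr (Or.inr (Or.inl ⟨L + 1, by omega, rfl, h⟩))
  · rcases (by omega : L = 4 ∨ L = 5 ∨ 6 ≤ L) with rfl | rfl | hL
    · exact Or.inr (Or.inr (Or.inr (Or.inr (Or.inl ⟨rfl, h⟩))))
    · exact Or.inr (Or.inr (Or.inr (Or.inr (Or.inr ⟨rfl, h⟩))))
    · refine absurd (four_le_of_two_two_four hl (h.embed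
        (fun k => if k ≤ 6 then k else k + L - 6) ?_ ?_ ?_ ?_)) (not_le.2 h4) <;>
      grind (splits := 25) [catPar, ParAdj]

/-- The arms are 1, 3, `L - 3`; the barriers are 1, 4, 4, then 1, 3, 6 and 2, 3, 3. -/
lemma lowCopy_of_one_three (hl : ∀ x : V → ℝ, quad (graphPower U 2) x ≤ l * ∑ u, x u ^ 2)
    (h4 : l < 4) {L x : ℕ} (hL : 6 ≤ L) (hL' : L ≤ 8) (hx : x < L + 2)
    (h : HasCopy U (L + 3) (catPar L 3 x 0)) : LowCopy U (L + 3) := by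
  rcases h.grow_pendant hl h4 (by omega) (by omega) hx with h | h | h
  · rcases hL.eq_or_lt with rfl | hL
    · exact Or.inr (Or.inr (Or.inr (Or.inl ⟨7, by omega, by omega, rfl,
        h.embed_list [7, 6, 5, 4, 3, 2, 1, 0, 8] (by decide +kernel)⟩)))
    · refine absurd (four_le_of_four_four hl (h.embed (fun k => if k ≤ 8 then k else L + 2)
        ?_ ?_ ?_ ?_)) (not_le.2 h4) <;>
      grind (splits := 25) [catPar, ParAdj]
  · rcases hL'.eq_or_lt with rfl | hL'
    · exact absurd (four_le_of_three_six hl h) (not_le.2 h4)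
    · exact Or.inr (Or.inr (Or.inr (Or.inl ⟨L + 1, by omega, by omega, rfl, h⟩)))
  · refine absurd (four_le_of_two_three_three hl (h.embed
      (fun k => if k ≤ 6 then k else k + L - 6) ?_ ?_ ?_ ?_)) (not_le.2 h4) <;>
    grind (splits := 25) [catPar, ParAdj]

lemma lowCopy_of_two_two_two (hl : ∀ x : V → ℝ, quad (graphPower U 2) x ≤ l * ∑ u, x u ^ 2)
    (h4 : l < 4) {x : ℕ} (hx : x < 7) (h : HasCopy U 8 (catPar 4 2 5 x)) : LowCopy U 8 := by
  have low : HasCopy U 8 (catPar 5 2 6 0) → LowCopy U 8 := fun h =>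
    Or.inr (Or.inr (Or.inr (Or.inr (Or.inr ⟨rfl, h⟩))))
  have star : HasCopy U 5 (catPar 2 1 1 0) → LowCopy U 8 := fun h =>
    absurd (four_le_of_star hl h) (not_le.2 h4)
  have branch : HasCopy U 7 (catPar 4 1 2 0) → LowCopy U 8 := fun h =>
    absurd (four_le_of_two_branches hl (s := 1) le_rfl h) (not_le.2 h4)
  interval_cases x
  · exact low (h.embed_list [4, 3, 2, 1, 0, 7, 5, 6] (by decide +kernel))
  · exact branch (h.embed_list [0, 1, 2, 3, 4, 7, 5] (by decide +kernel))
  · exact star (h.embed_list [1, 2, 3, 5, 7] (by decide +kernel))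
  · exact branch (h.embed_list [4, 3, 2, 1, 0, 7, 5] (by decide +kernel))
  · exact low (h.embed_list [0, 1, 2, 3, 4, 7, 5, 6] (by decide +kernel))
  · exact branch (h.embed_list [6, 5, 2, 1, 0, 7, 3] (by decide +kernel))
  · exact low (h.embed_list [0, 1, 2, 5, 6, 7, 3, 4] (by decide +kernel))

lemma four_le_of_two_two_three (hl : ∀ x : V → ℝ, quad (graphPower U 2) x ≤ l * ∑ u, x u ^ 2)
    {x : ℕ} (hx : x < 8) (h : HasCopy U 9 (catPar 5 2 6 x)) : 4 ≤ l := by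
  interval_cases x
  · exact four_le_of_two_three_three hl
      (h.embed_list [8, 0, 1, 2, 3, 4, 5, 6, 7] (by decide +kernel))
  · exact four_le_of_two_branches hl (s := 1) le_rfl
      (h.embed_list [0, 1, 2, 3, 4, 8, 6] (by decide +kernel))
  · exact four_le_of_star hl (h.embed_list [1, 2, 3, 6, 8] (by decide +kernel))
  · exact four_le_of_two_branches hl (s := 1) le_rfl
      (h.embed_list [4, 3, 2, 1, 0, 8, 6] (by decide +kernel))
  · exact four_le_of_two_branches hl (s := 2) (by omega)
      (h.embed_list [5, 4, 3, 2, 1, 0, 8, 6] (by decide +kernel))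
  · exact four_le_of_two_two_four hl
      (h.embed_list [0, 1, 2, 3, 4, 5, 8, 6, 7] (by decide +kernel))
  · exact four_le_of_two_branches hl (s := 1) le_rfl
      (h.embed_list [7, 6, 2, 1, 0, 8, 3] (by decide +kernel))
  · exact four_le_of_two_three_three hl
      (h.embed_list [8, 7, 6, 2, 3, 4, 5, 1, 0] (by decide +kernel))

/-- A connected graph with a vertex of degree at least three whose square has spectral radius
less than `4` has a spanning tree from a short list. -/
theorem exists_lowCopy (hl : ∀ x : V → ℝ, quad (graphPower U 2) x ≤ l * ∑ u, x u ^ 2)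
    (h4 : l < 4) (hU : U.Preconnected) (h : HasCopy U 4 (catPar 2 1 0 0)) {m : ℕ} (hm : 4 ≤ m)
    (hmV : m ≤ Fintype.card V) : LowCopy U m := by
  induction m, hm using Nat.le_induction with
  | base => exact Or.inl ⟨2, le_rfl, rfl, h⟩
  | succ m hm ih =>
    rcases ih (by omega) with ⟨L, hL, rfl, h⟩ | ⟨L, hL, rfl, h⟩ | ⟨L, hL, rfl, h⟩ |
      ⟨L, hL, hL', rfl, h⟩ | ⟨rfl, h⟩ | ⟨rfl, h⟩
    · obtain ⟨x, hx, h⟩ := h.extend_one hU (by omega) hmV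
      exact lowCopy_of_fork hl h4 hL hx h
    · obtain ⟨x, hx, h⟩ := h.extend_two hU (by omega) (by omega) hmV
      exact absurd (four_le_of_double_fork hl hL hx h) (not_le.2 h4)
    · obtain ⟨x, hx, h⟩ := h.extend_one hU (by omega) hmV
      exact lowCopy_of_one_two hl h4 hL hx h
    · obtain ⟨x, hx, h⟩ := h.extend_one hU (by omega) hmV
      exact lowCopy_of_one_three hl h4 hL hL' hx h
    · obtain ⟨x, hx, h⟩ := h.extend_two hU (by omega) (by omega) hmV
      exact lowCopy_of_two_two_two hl h4 hx h
    · obtain ⟨x, hx, h⟩ := h.extend_two hU (by omega) (by omega) hmV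
      exact absurd (four_le_of_two_two_three hl hx h) (not_le.2 h4)

end growth
-- The lollipop: its square, its Perron vector and upper bounds.
/-- A triangle on `0, 1, 2` with the path `2, 3, …, n - 1` attached, on the vertex set `Fin n`. -/
def lollipop (n : ℕ) : SimpleGraph (Fin n) where
  Adj i j := i.1 + 1 = j.1 ∨ j.1 + 1 = i.1 ∨ (i.1 = 0 ∧ j.1 = 2) ∨ (i.1 = 2 ∧ j.1 = 0)
  symm := ⟨fun i j h => by omega⟩
  loopless := ⟨fun i h => by omega⟩

lemma lollipop_adj {n : ℕ} {i j : Fin n} : (lollipop n).Adj i j ↔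
    i.1 + 1 = j.1 ∨ j.1 + 1 = i.1 ∨ (i.1 = 0 ∧ j.1 = 2) ∨ (i.1 = 2 ∧ j.1 = 0) := Iff.rfl

lemma lollipop_preconnected (n : ℕ) : (lollipop n).Preconnected := by
  have h : ∀ k (hk : k < n), (lollipop n).Reachable ⟨0, by omega⟩ ⟨k, hk⟩ := by
    intro k
    induction k with
    | zero => exact fun _ => .rfl
    | succ k ih =>
      exact fun hk => (ih (by omega)).trans
        (SimpleGraph.Adj.reachable (lollipop_adj.2 (Or.inl rfl)))
  exact fun i j => (h i i.2).symm.trans (h j j.2)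

/-- The neighbours of `i` in the square of the infinite lollipop. -/
def lolliNbr (i : ℕ) : Finset ℕ :=
  if i = 0 then {1, 2, 3} else if i = 1 then {0, 2, 3} else if i = 2 then {0, 1, 3, 4}
  else if i = 3 then {0, 1, 2, 4, 5} else {i - 2, i - 1, i + 1, i + 2}

lemma mem_lolliNbr {i j : ℕ} : j ∈ lolliNbr i ↔
    i ≠ j ∧ ((i ≤ j + 2 ∧ j ≤ i + 2) ∨ (i = 0 ∧ j = 3) ∨ (i = 3 ∧ j = 0)) := by
  unfold lolliNbr
  split_ifs <;> simp only [mem_insert, mem_singleton] <;> omega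

lemma lollipop_sq_adj {n : ℕ} {i j : Fin n} :
    (graphPower (lollipop n) 2).Adj i j ↔ j.1 ∈ lolliNbr i.1 := by
  rw [sq_adj_iff, mem_lolliNbr]
  constructor
  · rintro ⟨hne, h | ⟨k, h1, h2⟩⟩
    · have := Fin.val_ne_of_ne hne
      rw [lollipop_adj] at h
      omega
    · have := Fin.val_ne_of_ne hne
      rw [lollipop_adj] at h1 h2
      omega
  · rintro ⟨hne, h⟩
    refine ⟨fun h => hne (congrArg _ h), ?_⟩
    have hi := i.2
    have hj := j.2
    have cases : i.1 + 1 = j.1 ∨ j.1 + 1 = i.1 ∨ i.1 + 2 = j.1 ∨ j.1 + 2 = i.1 ∨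
      (i.1 = 0 ∧ j.1 = 3) ∨ (i.1 = 3 ∧ j.1 = 0) := by omega
    rcases cases with h | h | h | h | h | h
    · exact Or.inl (Or.inl h)
    · exact Or.inl (Or.inr (Or.inl h))
    · exact Or.inr ⟨⟨i + 1, by omega⟩, Or.inl rfl, Or.inl h⟩
    · exact Or.inr ⟨⟨j + 1, by omega⟩, Or.inr (Or.inl h), Or.inr (Or.inl rfl)⟩
    · exact Or.inr ⟨⟨2, by omega⟩, Or.inr (Or.inr (Or.inl ⟨h.1, rfl⟩)), Or.inl h.2.symm⟩
    · exact Or.inr ⟨⟨2, by omega⟩, Or.inr (Or.inl h.1.symm), Or.inr (Or.inr (Or.inr ⟨rfl, h.2⟩))⟩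

/-- `w` is a Perron vector of the square of the lollipop on `n` vertices, extended by zero. -/
structure IsLolliPerron (n : ℕ) (l : ℝ) (w : ℕ → ℝ) : Prop where
  pos : ∀ i < n, 0 < w i
  zero : ∀ i, n ≤ i → w i = 0
  eig : ∀ i < n, ∑ j ∈ lolliNbr i, w j = l * w i

lemma IsLolliPerron.nonneg {n : ℕ} {l : ℝ} {w : ℕ → ℝ} (h : IsLolliPerron n l w) (i : ℕ) :
    0 ≤ w i := by
  rcases lt_or_ge i n with hi | hi
  · exact (h.pos i hi).le
  · exact (h.zero i hi).ge

lemma exists_lolliPerron {n : ℕ} (hn : 0 < n) : ∃ (l : ℝ) (w : ℕ → ℝ), 0 ≤ l ∧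
    rhoSq (lollipop n) = ENNReal.ofReal l ∧
    (∀ x : Fin n → ℝ, quad (graphPower (lollipop n) 2) x ≤ l * ∑ u, x u ^ 2) ∧
    IsLolliPerron n l w := by
  have : Nonempty (Fin n) := ⟨⟨0, hn⟩⟩
  obtain ⟨l, hl0, hl, hR, z, hz0, hz, heig⟩ := exists_perron (graphPower (lollipop n) 2)
  have hpos := eigenvector_pos (sq_preconnected (lollipop_preconnected n)) hz0 hz heig
  have hw : ∀ i (hi : i < n), (if h : i < n then z ⟨i, h⟩ else 0) = z ⟨i, hi⟩ :=
    fun i hi => dif_pos hi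
  refine ⟨l, fun i => if h : i < n then z ⟨i, h⟩ else 0, hl0, hl, hR, ?_, ?_, ?_⟩
  · intro i hi
    rw [hw i hi]; exact hpos _
  · intro i hi
    exact dif_neg (not_lt.2 hi)
  · intro i hi
    rw [hw i hi, ← heig]
    have h1 : ∀ j : Fin n, adjInd (graphPower (lollipop n) 2) ⟨i, hi⟩ j * z j =
        (fun k => if k ∈ lolliNbr i then (if h : k < n then z ⟨k, h⟩ else 0) else 0) j.1 := by
      intro j
      by_cases hj : j.1 ∈ lolliNbr i
      · rw [adjInd_of_adj (lollipop_sq_adj.2 hj)]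
        simp [hj]
      · rw [adjInd_of_not_adj (fun h => hj (lollipop_sq_adj.1 h))]
        simp [hj]
    rw [sum_congr rfl fun j _ => h1 j, ← sum_range (fun k => if k ∈ lolliNbr i then
      (if h : k < n then z ⟨k, h⟩ else 0) else 0), ← sum_filter]
    symm
    refine sum_subset (fun j hj => (mem_filter.1 hj).2) fun j hj hj' => dif_neg fun h => ?_
    exact hj' (mem_filter.2 ⟨mem_range.2 h, hj⟩)

/-- A positive strict supersolution bounds the Perron root. -/
lemma IsLolliPerron.lt_of_supersolution {n : ℕ} (hn : 0 < n) {l μ : ℝ} {w : ℕ → ℝ}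
    (h : IsLolliPerron n l w) {y : ℕ → ℝ} (hy : ∀ k, 0 < y k)
    (hsup : ∀ k < n, ∑ j ∈ lolliNbr k, y j ≤ μ * y k) : l < μ := by
  obtain ⟨k₀, hk₀, hmax₀⟩ := exists_max_image (range n) (fun k => w k / y k)
    ⟨0, mem_range.2 hn⟩
  set r := w k₀ / y k₀ with hr
  have hr0 : 0 < r := div_pos (h.pos _ (mem_range.1 hk₀)) (hy _)
  have hle : ∀ j, w j ≤ r * y j := by
    intro j
    rcases lt_or_ge j n with hj | hj
    · exact (div_le_iff₀ (hy j)).1 (hmax₀ j (mem_range.2 hj))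
    · rw [h.zero j hj]; exact (mul_pos hr0 (hy j)).le
  have hS : ((range n).filter fun k => w k = r * y k).Nonempty :=
    ⟨k₀, mem_filter.2 ⟨hk₀, by rw [hr]; field_simp [(hy k₀).ne']⟩⟩
  -- At the largest index where `w / y` is maximal, the neighbour `k + 1` has a strictly smaller
  -- ratio, if only because `w` vanishes from `n` on. This makes the inequality strict.
  set k := ((range n).filter fun k => w k = r * y k).max' hS
  obtain ⟨hkn, hk⟩ := mem_filter.1 (max'_mem _ hS)
  have hkn : k < n := mem_range.1 hkn
  have hk : w k = r * y k := hk
  have hlt : w (k + 1) < r * y (k + 1) := by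
    refine lt_of_le_of_ne (hle _) fun heq => ?_
    rcases lt_or_ge (k + 1) n with hk1 | hk1
    · have : k + 1 ≤ k := le_max' ((range n).filter fun k => w k = r * y k) _
        (mem_filter.2 ⟨mem_range.2 hk1, heq⟩)
      omega
    · rw [h.zero _ hk1] at heq
      exact (mul_pos hr0 (hy (k + 1))).ne heq
  have h1 : ∑ j ∈ lolliNbr k, w j < ∑ j ∈ lolliNbr k, r * y j :=
    sum_lt_sum (fun j _ => hle j) ⟨k + 1, mem_lolliNbr.2 (by omega), hlt⟩
  rw [h.eig k hkn, ← mul_sum] at h1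
  have h2 := hsup k hkn
  have h3 : l * w k < μ * w k := by
    rw [hk] at h1 ⊢
    nlinarith
  exact lt_of_mul_lt_mul_right h3 (h.nonneg k)

lemma sum_lolliNbr_zero (y : ℕ → ℝ) : ∑ j ∈ lolliNbr 0, y j = y 1 + y 2 + y 3 := by
  simp [lolliNbr, add_assoc]

lemma sum_lolliNbr_one (y : ℕ → ℝ) : ∑ j ∈ lolliNbr 1, y j = y 0 + y 2 + y 3 := by
  simp [lolliNbr, add_assoc]

lemma sum_lolliNbr_two (y : ℕ → ℝ) : ∑ j ∈ lolliNbr 2, y j = y 0 + y 1 + y 3 + y 4 := by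
  simp [lolliNbr, add_assoc]

lemma sum_lolliNbr_three (y : ℕ → ℝ) :
    ∑ j ∈ lolliNbr 3, y j = y 0 + y 1 + y 2 + y 4 + y 5 := by
  simp [lolliNbr, add_assoc]

lemma sum_lolliNbr_add_four (y : ℕ → ℝ) (k : ℕ) :
    ∑ j ∈ lolliNbr (k + 4), y j = y (k + 2) + y (k + 3) + y (k + 5) + y (k + 6) := by
  have : lolliNbr (k + 4) = {k + 2, k + 3, k + 5, k + 6} := by simp [lolliNbr]
  rw [this, sum_insert (by simp), sum_insert (by simp), sum_pair (by simp)]; ring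

/-- On the infinite lollipop the weights 3, 3, 4, 5, 5, … solve the eigenvalue equation for 4
everywhere except at vertex 4, where 19 stands against 20. -/
lemma IsLolliPerron.lt_four {n : ℕ} (hn : 0 < n) {l : ℝ} {w : ℕ → ℝ}
    (h : IsLolliPerron n l w) : l < 4 := by
  refine h.lt_of_supersolution hn (y := fun k => if k ≤ 1 then 3 else if k = 2 then 4 else 5)
    (fun k => by split_ifs <;> norm_num) fun k _ => ?_
  match k with
  | 0 => rw [sum_lolliNbr_zero]; norm_num
  | 1 => rw [sum_lolliNbr_one]; norm_num
  | 2 => rw [sum_lolliNbr_two]; norm_num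
  | 3 => rw [sum_lolliNbr_three]; norm_num
  | k + 4 =>
    rw [sum_lolliNbr_add_four]
    simp only [show ¬ k + 4 ≤ 1 by omega, show ¬ k + 3 ≤ 1 by omega, show ¬ k + 2 ≤ 1 by omega,
      show ¬ k + 5 ≤ 1 by omega, show ¬ k + 6 ≤ 1 by omega, show k + 4 ≠ 2 by omega,
      show k + 3 ≠ 2 by omega, show k + 5 ≠ 2 by omega, show k + 6 ≠ 2 by omega, if_false]
    split_ifs <;> norm_num

/-- The value 1/20 sits on absent vertices: a supersolution must be positive on the whole infinite
lollipop, but should contribute little there. The next two bounds use the same device. -/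
lemma IsLolliPerron.lt_of_card_le_six {n : ℕ} (hn : 0 < n) (hn' : n ≤ 6) {l : ℝ} {w : ℕ → ℝ}
    (h : IsLolliPerron n l w) : l < 3.56 := by
  refine h.lt_of_supersolution hn
    (y := fun k => if k ≤ 1 then 20 else if k = 2 then 24 else if k = 3 then 27 else
      if k = 4 then 18 else if k = 5 then 13 else 1 / 20)
    (fun k => by split_ifs <;> norm_num) fun k hk => ?_
  have hk : k < 6 := by omega
  interval_cases k
  · rw [sum_lolliNbr_zero]; norm_num
  · rw [sum_lolliNbr_one]; norm_num
  · rw [sum_lolliNbr_two]; norm_num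
  · rw [sum_lolliNbr_three]; norm_num
  · rw [sum_lolliNbr_add_four _ 0]; norm_num
  · rw [sum_lolliNbr_add_four _ 1]; norm_num

lemma IsLolliPerron.lt_of_card_le_eight {n : ℕ} (hn : 0 < n) (hn' : n ≤ 8) {l : ℝ} {w : ℕ → ℝ}
    (h : IsLolliPerron n l w) : l < 3.8 := by
  refine h.lt_of_supersolution hn
    (y := fun k => if k ≤ 1 then 12 else if k = 2 then 15 else if k = 3 then 18 else
      if k = 4 then 15 else if k = 5 then 13 else if k = 6 then 9 else if k = 7 then 6
      else 1 / 20)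
    (fun k => by split_ifs <;> norm_num) fun k hk => ?_
  have hk : k < 8 := by omega
  interval_cases k
  · rw [sum_lolliNbr_zero]; norm_num
  · rw [sum_lolliNbr_one]; norm_num
  · rw [sum_lolliNbr_two]; norm_num
  · rw [sum_lolliNbr_three]; norm_num
  · rw [sum_lolliNbr_add_four _ 0]; norm_num
  · rw [sum_lolliNbr_add_four _ 1]; norm_num
  · rw [sum_lolliNbr_add_four _ 2]; norm_num
  · rw [sum_lolliNbr_add_four _ 3]; norm_num

lemma IsLolliPerron.lt_of_card_le_ten {n : ℕ} (hn : 0 < n) (hn' : n ≤ 10) {l : ℝ} {w : ℕ → ℝ}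
    (h : IsLolliPerron n l w) : l < 3.85 := by
  refine h.lt_of_supersolution hn
    (y := fun k => if k ≤ 1 then 31 else if k = 2 then 40 else if k = 3 then 48 else
      if k = 4 then 42 else if k = 5 then 39 else if k = 6 then 33 else if k = 7 then 27
      else if k = 8 then 19 else if k = 9 then 12 else 1 / 20)
    (fun k => by split_ifs <;> norm_num) fun k hk => ?_
  have hk : k < 10 := by omega
  interval_cases k
  · rw [sum_lolliNbr_zero]; norm_num
  · rw [sum_lolliNbr_one]; norm_num
  · rw [sum_lolliNbr_two]; norm_num
  · rw [sum_lolliNbr_three]; norm_num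
  · rw [sum_lolliNbr_add_four _ 0]; norm_num
  · rw [sum_lolliNbr_add_four _ 1]; norm_num
  · rw [sum_lolliNbr_add_four _ 2]; norm_num
  · rw [sum_lolliNbr_add_four _ 3]; norm_num
  · rw [sum_lolliNbr_add_four _ 4]; norm_num
  · rw [sum_lolliNbr_add_four _ 5]; norm_num

/-- On at least seven vertices the fifth Perron entry exceeds those of the two leaves. -/
lemma IsLolliPerron.lt_entry_four {n : ℕ} (hn : 7 ≤ n) {l : ℝ} {w : ℕ → ℝ}
    (h : IsLolliPerron n l w) (hl : 3.65 ≤ l) : w 1 = w 0 ∧ w 0 < w 4 := by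
  have e0 := h.eig 0 (by omega)
  have e1 := h.eig 1 (by omega)
  have e2 := h.eig 2 (by omega)
  have e3 := h.eig 3 (by omega)
  have e4 := h.eig 4 (by omega)
  rw [sum_lolliNbr_zero] at e0
  rw [sum_lolliNbr_one] at e1
  rw [sum_lolliNbr_two] at e2
  rw [sum_lolliNbr_three] at e3
  rw [sum_lolliNbr_add_four w 0] at e4
  norm_num at e4
  have p0 := h.pos 0 (by omega)
  have p6 := h.pos 6 (by omega)
  have h10 : w 1 = w 0 := by
    have : (l + 1) * (w 1 - w 0) = 0 := by linear_combination e0 - e1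
    rcases mul_eq_zero.1 this with h | h <;> linarith
  refine ⟨h10, ?_⟩
  rw [h10] at e0 e2 e3
  by_contra hcon
  push Not at hcon
  -- Eliminating the other entries expresses `w 6` by `w 4` and `w 0`. If `w 4 ≤ w 0`, then `w 6`
  -- would be negative as soon as `l ^ 2 - 2 * l - 6 > 0`, that is, for `l > 1 + √7`.
  have h6 : w 6 = (l + 2) * w 4 - (l ^ 2 - l - 4) * w 0 := by
    linear_combination e4 - e3 - e2 - l * e0
  have hq : 0 < l ^ 2 - 2 * l - 6 := by nlinarith
  nlinarith [mul_pos hq p0, mul_nonneg (by linarith : (0 : ℝ) ≤ l + 2) (sub_nonneg.2 hcon)]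

/-! ### Comparing a graph with the lollipop through the Perron vector. -/

lemma sum_fin_fin (n : ℕ) (B : ℕ → ℕ → ℝ) :
    ∑ i : Fin n, ∑ j : Fin n, B i j = ∑ i ∈ range n, ∑ j ∈ range n, B i j := by
  rw [sum_range]
  exact sum_congr rfl fun i _ => (sum_range fun j => B i j).symm

lemma sum_single_entry {n a b : ℕ} (ha : a < n) (hb : b < n) (w : ℕ → ℝ) :
    ∑ i ∈ range n, ∑ j ∈ range n, (if i = a ∧ j = b then (1 : ℝ) else 0) * (w i * w j)
      = w a * w b := by
  rw [sum_eq_single_of_mem a (mem_range.2 ha) fun i _ hi => by simp [hi],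
    sum_eq_single_of_mem b (mem_range.2 hb) fun j _ hj => by simp [hj]]
  simp

section compare
variable {V : Type*} [Fintype V] {n : ℕ} {l m : ℝ} {w : ℕ → ℝ}

/-- The Perron vector `w` serves as test vector on `G`. `D` bounds from below the change of the
adjacency matrix, so a positive form of `D` at `w` raises the Rayleigh quotient above `l`. -/
lemma IsLolliPerron.lt_of_perturbation (h : IsLolliPerron n l w) {G : SimpleGraph V}
    (hm : ∀ x : V → ℝ, quad G x ≤ m * ∑ u, x u ^ 2) {e : ℕ → V} (he : Set.InjOn e (Set.Iio n))
    (D : ℕ → ℕ → ℝ)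
    (hD : ∀ i < n, ∀ j < n, (if j ∈ lolliNbr i then 1 else 0) + D i j ≤ adjInd G (e i) (e j))
    (hpos : 0 < ∑ i ∈ range n, ∑ j ∈ range n, D i j * (w i * w j)) : l < m := by
  have h1 := rayleigh_of_injective hm (f := fun i : Fin n => e i)
    (fun i j hij => Fin.ext (he i.2 j.2 hij)) fun i => w i
  rw [sum_fin_fin n fun i j => adjInd G (e i) (e j) * (w i * w j), ← sum_range fun i => w i ^ 2]
    at h1
  have h2 : ∑ i ∈ range n, ∑ j ∈ range n, (if j ∈ lolliNbr i then (1 : ℝ) else 0) * (w i * w j)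
      = l * ∑ i ∈ range n, w i ^ 2 := by
    rw [mul_sum]
    refine sum_congr rfl fun i hi => ?_
    have h3 : ∑ j ∈ range n, (if j ∈ lolliNbr i then (1 : ℝ) else 0) * (w i * w j)
        = w i * ∑ j ∈ lolliNbr i, w j := by
      rw [mul_sum]
      simp only [ite_mul, one_mul, zero_mul]
      rw [← sum_filter]
      refine sum_subset (fun j hj => (mem_filter.1 hj).2) fun j hj hj' => ?_
      rw [h.zero j (not_lt.1 fun hjn => hj' (mem_filter.2 ⟨mem_range.2 hjn, hj⟩)), mul_zero]
    rw [h3, h.eig i (mem_range.1 hi)]; ring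
  have h4 : ∑ i ∈ range n, ∑ j ∈ range n,
      ((if j ∈ lolliNbr i then (1 : ℝ) else 0) * (w i * w j) + D i j * (w i * w j))
      ≤ ∑ i ∈ range n, ∑ j ∈ range n, adjInd G (e i) (e j) * (w i * w j) := by
    refine sum_le_sum fun i hi => sum_le_sum fun j hj => ?_
    rw [← add_mul]
    exact mul_le_mul_of_nonneg_right (hD i (mem_range.1 hi) j (mem_range.1 hj))
      (mul_nonneg (h.nonneg i) (h.nonneg j))
  simp only [sum_add_distrib] at h4
  rw [h2] at h4
  refine lt_of_mul_lt_mul_right ?_ (sum_nonneg fun i _ => sq_nonneg (w i) :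
    0 ≤ ∑ i ∈ range n, w i ^ 2)
  linarith

/-- A spanning copy of the square of the lollipop with an additional edge. -/
lemma IsLolliPerron.lt_of_extra_edge (h : IsLolliPerron n l w) {G : SimpleGraph V}
    (hm : ∀ x : V → ℝ, quad G x ≤ m * ∑ u, x u ^ 2) {e : ℕ → V} (he : Set.InjOn e (Set.Iio n))
    (hom : ∀ i < n, ∀ j < n, i < j → j ∈ lolliNbr i → G.Adj (e i) (e j))
    {a b : ℕ} (ha : a < n) (hb : b < n) (hab : b ∉ lolliNbr a) (hadj : G.Adj (e a) (e b)) :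
    l < m := by
  -- Only an entrywise lower bound is required, so one ordered pair of the new edge is enough.
  refine h.lt_of_perturbation hm he (fun i j => if i = a ∧ j = b then 1 else 0)
    (fun i hi j hj => ?_) ?_
  · by_cases h1 : i = a ∧ j = b
    · obtain ⟨rfl, rfl⟩ := h1
      simp [hab, adjInd_of_adj hadj]
    · rw [if_neg h1, add_zero]
      split_ifs with h2
      · rw [adjInd_of_adj]
        rcases lt_trichotomy i j with h3 | h3 | h3
        · exact hom i hi j hj h3 h2
        · exact absurd h3 (mem_lolliNbr.1 h2).1
        · refine (hom j hj i hi h3 ?_).symm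
          rw [mem_lolliNbr] at h2 ⊢; omega
      · exact adjInd_nonneg _ _ _
  · rw [sum_single_entry ha hb]
    exact mul_pos (h.pos a ha) (h.pos b hb)

/-- A spanning copy of the square of the lollipop with the edge `01` replaced by `04`. -/
lemma IsLolliPerron.lt_of_moved_edge (h : IsLolliPerron n l w) (hn : 5 ≤ n) (h10 : w 1 = w 0)
    (h04 : w 0 < w 4) {G : SimpleGraph V}
    (hm : ∀ x : V → ℝ, quad G x ≤ m * ∑ u, x u ^ 2) {e : ℕ → V} (he : Set.InjOn e (Set.Iio n))
    (hom : ∀ i < n, ∀ j < n, i < j → j ∈ lolliNbr i → ¬ (i = 0 ∧ j = 1) → G.Adj (e i) (e j))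
    (hadj : G.Adj (e 0) (e 4)) : l < m := by
  -- The form of this change is `2 * w 0 * (w 4 - w 1)`, which is positive.
  refine h.lt_of_perturbation hm he (fun i j => ((if i = 0 ∧ j = 4 then 1 else 0) +
    (if i = 4 ∧ j = 0 then 1 else 0)) + (-(if i = 0 ∧ j = 1 then 1 else 0) -
    (if i = 1 ∧ j = 0 then 1 else 0)))
    (fun i hi j hj => ?_) ?_
  · have hom' : j ∈ lolliNbr i → ¬ (i = 0 ∧ j = 1) → ¬ (i = 1 ∧ j = 0) →
        adjInd G (e i) (e j) = 1 := by
      intro h2 h3 h4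
      refine adjInd_of_adj ?_
      rcases lt_trichotomy i j with h5 | h5 | h5
      · exact hom i hi j hj h5 h2 h3
      · exact absurd h5 (mem_lolliNbr.1 h2).1
      · refine (hom j hj i hi h5 ?_ (by omega)).symm
        rw [mem_lolliNbr] at h2 ⊢; omega
    have hnn := adjInd_nonneg G (e i) (e j)
    by_cases c1 : i = 0 ∧ j = 4
    · obtain ⟨rfl, rfl⟩ := c1
      rw [adjInd_of_adj hadj]; simp [lolliNbr]
    by_cases c2 : i = 4 ∧ j = 0
    · obtain ⟨rfl, rfl⟩ := c2
      rw [adjInd_of_adj hadj.symm]; simp [lolliNbr]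
    by_cases c3 : i = 0 ∧ j = 1
    · obtain ⟨rfl, rfl⟩ := c3
      simpa [lolliNbr] using hnn
    by_cases c4 : i = 1 ∧ j = 0
    · obtain ⟨rfl, rfl⟩ := c4
      simpa [lolliNbr] using hnn
    simp only [c1, c2, c3, c4, if_false]
    split_ifs with h2
    · rw [hom' h2 c3 c4]; norm_num
    · simpa using hnn
  · simp only [add_mul, sub_mul, neg_mul, sum_add_distrib, sum_sub_distrib, sum_neg_distrib]
    rw [sum_single_entry (by omega) (by omega), sum_single_entry (by omega) (by omega),
      sum_single_entry (by omega) (by omega), sum_single_entry (by omega) (by omega), h10]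
    have := h.pos 0 (by omega)
    nlinarith

lemma lollipop_hasCopy (hn : 7 ≤ n) : HasCopy (lollipop n) 7 (catPar 5 1 0 0) := by
  refine ⟨fun k => if h : k ≤ 5 then ⟨k + 1, by omega⟩ else ⟨0, by omega⟩, ?_, ?_⟩
  · intro a ha b hb hab
    have ha : a < 7 := ha
    have hb : b < 7 := hb
    simp only at hab
    split_ifs at hab <;> simp only [Fin.mk.injEq] at hab <;> omega
  · intro k h0 hk
    have hk' : k ≤ 6 := by omega
    rcases (by omega : k ≤ 5 ∨ k = 6) with h | rfl
    · have h1 : catPar 5 1 0 0 k = k - 1 := by simp [catPar, h]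
      rw [h1]
      beta_reduce
      rw [dif_pos h, dif_pos (by omega)]
      refine Or.inl ?_
      simp only; omega
    · exact Or.inr (Or.inr (Or.inr ⟨rfl, rfl⟩))

/-- `e` enumerates a spanning fork of `U`: the path `1, 2, …, n - 1` and the edge `02`. -/
structure IsSpanningFork (U : SimpleGraph V) (n : ℕ) (e : ℕ → V) : Prop where
  injOn : Set.InjOn e (Set.Iio n)
  path : ∀ i, 1 ≤ i → i + 1 < n → U.Adj (e i) (e (i + 1))
  pendant : U.Adj (e 0) (e 2)

/-- The edge `01` missing from the fork reappears in its square through the common neighbour 2. -/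
lemma IsSpanningFork.sq_adj {U : SimpleGraph V} {e : ℕ → V} (h : IsSpanningFork U n e)
    (hn : 3 ≤ n) (i : ℕ)
    (hi : i < n) (j : ℕ) (hj : j < n) (hij : i < j) (hmem : j ∈ lolliNbr i) :
    (graphPower U 2).Adj (e i) (e j) := by
  have hne : e i ≠ e j := fun heq => hij.ne (h.injOn hi hj heq)
  rw [mem_lolliNbr] at hmem
  rcases (by omega : (i = 0 ∧ j = 1) ∨ (i = 0 ∧ j = 2) ∨ (i = 0 ∧ j = 3) ∨ (1 ≤ i ∧ j = i + 1) ∨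
    (1 ≤ i ∧ j = i + 2)) with ⟨rfl, rfl⟩ | ⟨rfl, rfl⟩ | ⟨rfl, rfl⟩ | ⟨h1, rfl⟩ | ⟨h1, rfl⟩
  · exact sq_adj_of_common h.pendant (h.path 1 le_rfl hn).symm hne
  · exact sq_adj_of_adj h.pendant
  · exact sq_adj_of_common h.pendant (h.path 2 (by omega) hj) hne
  · exact sq_adj_of_adj (h.path i h1 hj)
  · exact sq_adj_of_common (h.path i h1 (by omega)) (h.path (i + 1) (by omega) hj) hne

/-- The square of a connected graph with a vertex of degree at least three has larger spectral
radius than the square of the lollipop, unless the graph has a spanning fork. -/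
theorem IsLolliPerron.lt_or_spanningFork (h : IsLolliPerron n l w)
    (hR : ∀ x : Fin n → ℝ, quad (graphPower (lollipop n) 2) x ≤ l * ∑ u, x u ^ 2)
    (hn : 4 ≤ n) (hV : Fintype.card V = n) {U : SimpleGraph V} (hU : U.Preconnected)
    (hm : ∀ x : V → ℝ, quad (graphPower U 2) x ≤ m * ∑ u, x u ^ 2)
    (hstar : HasCopy U 4 (catPar 2 1 0 0)) : l < m ∨ ∃ e, IsSpanningFork U n e := by
  have hn0 : 0 < n := by omega
  rcases lt_or_ge m 4 with h4 | h4
  swap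
  · exact Or.inl ((h.lt_four hn0).trans_le h4)
  rcases exists_lowCopy hm h4 hU hstar hn hV.ge with ⟨L, hL, hLn, f, hf⟩ | ⟨L, hL, hLn, f, hf⟩ |
    ⟨L, hL, hLn, hc⟩ | ⟨L, hL, hL', hLn, hc⟩ | ⟨hLn, hc⟩ | ⟨hLn, hc⟩
  · refine Or.inr ⟨fun i => f (if i = 0 then L + 1 else i - 1), ?_, ?_, ?_⟩
    · intro a ha b hb hab
      have ha : a < n := ha
      have hb : b < n := hb
      have := hf.1 (show (if a = 0 then L + 1 else a - 1) < n by split_ifs <;> omega)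
        (show (if b = 0 then L + 1 else b - 1) < n by split_ifs <;> omega) hab
      split_ifs at this <;> omega
    · intro i h1 h2
      exact hf.adj (by grind) (by grind) (by grind [ParAdj, catPar])
    · exact hf.adj (by grind) (by grind) (by grind [ParAdj, catPar])
  · left
    set e : ℕ → V := fun i => f (if i = 0 then L + 1 else if i ≤ L + 1 then i - 1 else L + 2)
      with he_def
    have he : Set.InjOn e (Set.Iio n) := by
      intro a ha b hb hab
      have ha : a < n := ha
      have hb : b < n := hb
      have := hf.1
        (show (if a = 0 then L + 1 else if a ≤ L + 1 then a - 1 else L + 2) < n by grind)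
        (show (if b = 0 then L + 1 else if b ≤ L + 1 then b - 1 else L + 2) < n by grind) hab
      grind
    have hpath : ∀ i, 1 ≤ i → i + 1 < L + 2 → U.Adj (e i) (e (i + 1)) := fun i h1 h2 =>
      hf.adj (by grind) (by grind) (by grind [ParAdj, catPar])
    have hpend : U.Adj (e 0) (e 2) :=
      hf.adj (by grind) (by grind) (by grind [ParAdj, catPar])
    have hend : U.Adj (e L) (e (L + 2)) :=
      hf.adj (by grind) (by grind) (by grind [ParAdj, catPar])
    have hfork : IsSpanningFork U (L + 2) e := ⟨he.mono fun a ha => by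
      have ha : a < L + 2 := ha
      show a < n
      omega, hpath, hpend⟩
    have hne : ∀ i, i < L + 2 → e i ≠ e (L + 2) := fun i hi heq => by
      have := he (show i < n by omega) (show L + 2 < n by omega) heq
      omega
    -- The second leaf at the far end hangs at `L` instead of `L + 1`. It is still joined to both in
    -- the square, and gains `L - 1`.
    refine h.lt_of_extra_edge hm he (fun i hi j hj hij hmem => ?_) (a := L - 1) (b := L + 2)
      (by omega) (by omega) (by rw [mem_lolliNbr]; omega) ?_
    · rcases (by omega : j < L + 2 ∨ j = L + 2) with hj' | rfl
      · exact hfork.sq_adj (by omega) i (by omega) j hj' hij hmem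
      · rw [mem_lolliNbr] at hmem
        rcases (by omega : i = L ∨ i = L + 1) with rfl | rfl
        · exact sq_adj_of_adj hend
        · exact sq_adj_of_common (hpath L (by omega) (by omega)).symm hend (hne _ (by omega))
    · have := hpath (L - 1) (by omega) (by omega)
      rw [show L - 1 + 1 = L by omega] at this
      exact sq_adj_of_common this hend (hne _ (by omega))
  · left
    -- Order 6 is settled numerically, since the comparison of Perron entries needs seven vertices.
    rcases hL.eq_or_lt with rfl | hL
    · subst hLn
      exact (h.lt_of_card_le_six hn0 le_rfl).trans_le
        ((by norm_num : (3.56 : ℝ) ≤ 3.58).trans (le_of_one_two_two hm hc))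
    obtain ⟨f, hf⟩ := hc
    obtain ⟨h10, h04⟩ := h.lt_entry_four (by omega)
      (le_of_fork_seven hR (lollipop_hasCopy (by omega)))
    set e : ℕ → V := fun i => f (if i = 0 then L + 1 else i - 1) with he_def
    have he : Set.InjOn e (Set.Iio n) := by
      intro a ha b hb hab
      have ha : a < n := ha
      have hb : b < n := hb
      have := hf.1 (show (if a = 0 then L + 1 else a - 1) < n by split_ifs <;> omega)
        (show (if b = 0 then L + 1 else b - 1) < n by split_ifs <;> omega) hab
      split_ifs at this <;> omega
    have hpath : ∀ i, 1 ≤ i → i + 1 < n → U.Adj (e i) (e (i + 1)) := fun i h1 h2 =>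
      hf.adj (by grind) (by grind) (by grind [ParAdj, catPar])
    have hpend : U.Adj (e 0) (e 3) :=
      hf.adj (by grind) (by grind) (by grind [ParAdj, catPar])
    have hne : ∀ i j, i < j → j < n → e i ≠ e j := fun i j hi hj heq => by
      have := he (show i < n by omega) hj heq
      omega
    -- Here 0 hangs at 3 instead of 2, so the square may lose `01` but gains `04`.
    refine h.lt_of_moved_edge (by omega) h10 h04 hm he (fun i hi j hj hij hmem hnot => ?_)
      (sq_adj_of_common hpend (hpath 3 (by omega) (by omega)) (hne 0 4 (by omega) (by omega)))
    rw [mem_lolliNbr] at hmem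
    rcases (by omega : (i = 0 ∧ j = 2) ∨ (i = 0 ∧ j = 3) ∨ (1 ≤ i ∧ j = i + 1) ∨
      (1 ≤ i ∧ j = i + 2)) with ⟨rfl, rfl⟩ | ⟨rfl, rfl⟩ | ⟨h1, rfl⟩ | ⟨h1, rfl⟩
    · exact sq_adj_of_common hpend (hpath 2 (by omega) (by omega)).symm (hne _ _ hij hj)
    · exact sq_adj_of_adj hpend
    · exact sq_adj_of_adj (hpath i h1 hj)
    · exact sq_adj_of_common (hpath i h1 (by omega)) (hpath (i + 1) (by omega) hj)
        (hne _ _ hij hj)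
  · left
    have hc' : HasCopy U 8 (catPar 6 3 0 0) := by
      refine hc.embed (fun k => if k ≤ 6 then k else L + 1) ?_ ?_ ?_ ?_ <;>
      grind [catPar, ParAdj]
    exact (h.lt_of_card_le_ten hn0 (by omega)).trans_le
      ((by norm_num : (3.85 : ℝ) ≤ 3.87).trans (le_of_one_three_three hm hc'))
  · exact Or.inl ((h.lt_of_card_le_eight hn0 (by omega)).trans_le
      ((by norm_num : (3.8 : ℝ) ≤ 3.82).trans (le_of_two_two_two hm hc)))
  · have hc' : HasCopy U 7 (catPar 4 2 5 0) :=
      hc.embed_list [0, 1, 2, 3, 4, 6, 7] (by decide +kernel)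
    exact Or.inl ((h.lt_of_card_le_eight hn0 (by omega)).trans_le
      ((by norm_num : (3.8 : ℝ) ≤ 3.82).trans (le_of_two_two_two hm hc')))

end compare
-- Cycles in unicyclic graphs.
section cycles
variable {V : Type*} {U : SimpleGraph V}

lemma fin_add_one_ne_sub_one {k : ℕ} (i : Fin (k + 3)) : i + 1 ≠ i - 1 := by
  intro h
  have h2 : (1 : Fin (k + 3)) + 1 = 0 := by
    have : i + (1 + 1) = i + 0 := by rw [← add_assoc, h]; simp
    exact add_left_cancel this
  have := congrArg Fin.val h2
  simp [Fin.val_add] at this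
  rw [Nat.mod_eq_of_lt (by omega)] at this
  omega

lemma IsUnicyclic.exists_cyclic_enumeration (hU : IsUnicyclic U) :
    ∃ (k : ℕ) (φ : Fin (k + 3) → V), Function.Injective φ ∧ ∀ i, U.Adj (φ i) (φ (i + 1)) := by
  obtain ⟨H, ⟨v, p, hp, -⟩, -⟩ := hU.2
  have h3 := hp.three_le_length
  obtain ⟨k, hk⟩ : ∃ k, p.length = k + 3 := ⟨p.length - 3, by omega⟩
  have hc : SimpleGraph.IsContained (SimpleGraph.cycleGraph (k + 3)) U :=
    (SimpleGraph.cycleGraph_isContained_iff (by omega)).2 ⟨v, p, hp, hk⟩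
  obtain ⟨φ⟩ := hc
  refine ⟨k, φ, φ.injective, fun i => φ.toHom.map_adj ?_⟩
  rw [SimpleGraph.cycleGraph_adj]
  exact Or.inr (by simp)

lemma adj_sub_one {k : ℕ} {φ : Fin (k + 3) → V} (h : ∀ i, U.Adj (φ i) (φ (i + 1)))
    (i : Fin (k + 3)) : U.Adj (φ i) (φ (i - 1)) := by
  have := h (i - 1)
  rw [sub_add_cancel] at this
  exact this.symm

/-- A graph in which every vertex has at most one neighbour of larger rank is not unicyclic. -/
lemma not_isUnicyclic_of_rank (r : V → ℕ) (hr : Function.Injective r)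
    (h : ∀ v a b, U.Adj v a → U.Adj v b → r v < r a → r v < r b → a = b) : ¬ IsUnicyclic U := by
  intro hU
  obtain ⟨k, φ, hφ, hadj⟩ := hU.exists_cyclic_enumeration
  -- The vertex of least rank on the cycle has two cycle neighbours of larger rank.
  obtain ⟨i, -, hi⟩ := exists_min_image univ (fun i => r (φ i)) ⟨0, mem_univ _⟩
  have hlt : ∀ j, U.Adj (φ i) (φ j) → r (φ i) < r (φ j) := fun j hj =>
    lt_of_le_of_ne (hi j (mem_univ _)) fun h => hj.ne (hr h)
  exact fin_add_one_ne_sub_one i (hφ (h _ _ _ (hadj i) (adj_sub_one hadj i)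
    (hlt _ (hadj i)) (hlt _ (adj_sub_one hadj i))))

/-- A unicyclic graph without vertices of degree at least three is a cycle. -/
lemma IsUnicyclic.iso_cycleGraph [Fintype V] (hU : IsUnicyclic U) {n : ℕ}
    (hV : Fintype.card V = n)
    (h : ∀ v a b c, U.Adj v a → U.Adj v b → U.Adj v c → a ≠ b → a ≠ c → b = c) :
    Nonempty (U ≃g SimpleGraph.cycleGraph n) := by
  obtain ⟨k, φ, hφ, hadj⟩ := hU.exists_cyclic_enumeration
  have hnbr : ∀ i a, U.Adj (φ i) a → a = φ (i + 1) ∨ a = φ (i - 1) := by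
    intro i a ha
    by_contra hcon
    push Not at hcon
    exact fin_add_one_ne_sub_one i (hφ (h _ a _ _ ha (hadj i) (adj_sub_one hadj i)
      hcon.1 hcon.2))
  have walk : ∀ {a b} (_ : U.Walk a b), (∃ i, φ i = a) → ∃ i, φ i = b := by
    intro a b p
    induction p with
    | nil => exact id
    | cons hab _ ih =>
      rintro ⟨i, rfl⟩
      rcases hnbr i _ hab with rfl | rfl
      · exact ih ⟨_, rfl⟩
      · exact ih ⟨_, rfl⟩
  have hbij : Function.Bijective φ := ⟨hφ, fun v => by
    obtain ⟨p⟩ := hU.1.preconnected (φ 0) v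
    exact walk p ⟨0, rfl⟩⟩
  have hn : n = k + 3 := by
    rw [← hV, ← Fintype.card_of_bijective hbij, Fintype.card_fin]
  subst hn
  refine ⟨SimpleGraph.Iso.symm ⟨Equiv.ofBijective φ hbij, fun {i j} => ?_⟩⟩
  rw [SimpleGraph.cycleGraph_adj]
  show U.Adj (φ i) (φ j) ↔ _
  constructor
  · intro hij
    rcases hnbr i _ hij with h | h
    · exact Or.inr (by rw [hφ h]; simp)
    · exact Or.inl (by rw [hφ h]; simp)
  · rintro (h | h)
    · rw [show j = i - 1 by rw [← h]; simp]
      exact adj_sub_one hadj i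
    · rw [show j = i + 1 by rw [← h]; simp]
      exact hadj i

lemma exists_triangle_subgraph {x y z : V} (hxy : U.Adj x y) (hyz : U.Adj y z)
    (hzx : U.Adj z x) : ∃ H : U.Subgraph, (∃ (v : V) (p : U.Walk v v), p.IsCycle ∧
      p.toSubgraph = H) ∧ H.verts = {x, y, z} := by
  refine ⟨_, ⟨x, .cons hxy (.cons hyz (.cons hzx .nil)), ?_, rfl⟩, ?_⟩
  · rw [SimpleGraph.Walk.cons_isCycle_iff]
    refine ⟨?_, ?_⟩
    · simp [SimpleGraph.Walk.cons_isPath_iff, hyz.ne, hzx.ne, hxy.ne.symm]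
    · simp [hxy.ne, hyz.ne, hzx.ne.symm, hxy.ne.symm]
  · ext a
    simp
    tauto

/-- In a unicyclic graph two triangles with a common edge coincide. -/
lemma IsUnicyclic.triangle_unique (hU : IsUnicyclic U) {x y z t : V} (hxy : U.Adj x y)
    (hxz : U.Adj x z) (hyz : U.Adj y z) (hxt : U.Adj x t) (hyt : U.Adj y t) : z = t := by
  obtain ⟨H, h1, h2⟩ := exists_triangle_subgraph hxy hyz hxz.symm
  obtain ⟨H', h1', h2'⟩ := exists_triangle_subgraph hxy hyt hxt.symm
  rw [hU.2.unique h1 h1', h2'] at h2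
  have : z ∈ ({x, y, t} : Set V) := by rw [h2]; simp
  simp only [Set.mem_insert_iff, Set.mem_singleton_iff] at this
  rcases this with h | h | h
  · exact absurd h hxz.ne.symm
  · exact absurd h hyz.ne.symm
  · exact h

end cycles
-- Identifying the extremal graph from a spanning fork.
section extremal
variable {V : Type*} [Fintype V] {n : ℕ} {U : SimpleGraph V}

lemma IsSpanningFork.bijective {e : ℕ → V} (he : IsSpanningFork U n e)
    (hV : Fintype.card V = n) : Function.Bijective fun i : Fin n => e i :=
  (Fintype.bijective_iff_injective_and_card _).2
    ⟨fun i j h => Fin.ext (he.injOn i.2 j.2 h), by rw [Fintype.card_fin, hV]⟩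

/-- A unicyclic graph with a spanning fork whose only possible chord joins the two leaves. -/
lemma IsSpanningFork.iso_lollipop {e : ℕ → V} (he : IsSpanningFork U n e)
    (hV : Fintype.card V = n) (hU : IsUnicyclic U)
    (hadj : ∀ i j, i < j → j < n → U.Adj (e i) (e j) → j = i + 1 ∨ (i = 0 ∧ j = 2)) :
    Nonempty (U ≃g lollipop n) := by
  set E := Equiv.ofBijective _ (he.bijective hV) with hE
  have hEi : ∀ i, E i = e i.1 := fun _ => rfl
  -- Without this edge every vertex has at most one neighbour of larger index, so `U` would have no
  -- cycle.
  have h01 : U.Adj (e 0) (e 1) := by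
    by_contra hno
    refine not_isUnicyclic_of_rank (fun v => (E.symm v).1)
      (fun a b h => E.symm.injective (Fin.ext h)) (fun v a b ha hb hva hvb => ?_) hU
    obtain ⟨i, rfl⟩ := E.surjective v
    obtain ⟨j, rfl⟩ := E.surjective a
    obtain ⟨k, rfl⟩ := E.surjective b
    simp only [Equiv.symm_apply_apply] at hva hvb
    rw [hEi, hEi] at ha hb
    have h1 := hadj i j hva j.2 ha
    have h2 := hadj i k hvb k.2 hb
    have h3 : ¬ (i.1 = 0 ∧ j.1 = 1) := fun h => hno (by rwa [h.1, h.2] at ha)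
    have h4 : ¬ (i.1 = 0 ∧ k.1 = 1) := fun h => hno (by rwa [h.1, h.2] at hb)
    rw [Fin.ext (by omega : j.1 = k.1)]
  have key : ∀ i j, i < j → j < n → (U.Adj (e i) (e j) ↔ j = i + 1 ∨ (i = 0 ∧ j = 2)) := by
    intro i j hij hj
    refine ⟨hadj i j hij hj, ?_⟩
    rintro (rfl | ⟨rfl, rfl⟩)
    · rcases Nat.eq_zero_or_pos i with rfl | hi
      · exact h01
      · exact he.path i hi hj
    · exact he.pendant
  refine ⟨SimpleGraph.Iso.symm ⟨E, fun {i j} => ?_⟩⟩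
  rw [hEi, hEi, lollipop_adj]
  rcases lt_trichotomy i.1 j.1 with h | h | h
  · rw [key _ _ h j.2]; omega
  · rw [h]
    refine ⟨fun h' => absurd rfl h'.ne, fun h' => ?_⟩
    omega
  · rw [U.adj_comm, key _ _ h i.2]; omega

/-- On four vertices the fork is a star with centre 2. After relabelling, an edge between leaves
becomes `01`, and a second such edge would give two triangles with a common edge. -/
lemma IsSpanningFork.iso_lollipop_four {e : ℕ → V} (he : IsSpanningFork U 4 e)
    (hV : Fintype.card V = 4) (hU : IsUnicyclic U) : Nonempty (U ≃g lollipop 4) := by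
  have main : ∀ e : ℕ → V, IsSpanningFork U 4 e → U.Adj (e 0) (e 1) →
      Nonempty (U ≃g lollipop 4) := by
    intro e he h01
    have hne : e 1 ≠ e 3 := fun h => by
      have := he.injOn (show 1 < 4 by omega) (show 3 < 4 by omega) h
      omega
    have hne' : e 0 ≠ e 3 := fun h => by
      have := he.injOn (show 0 < 4 by omega) (show 3 < 4 by omega) h
      omega
    have h12 := he.path 1 le_rfl (by omega)
    have h23 := he.path 2 (by omega) (by omega)
    refine he.iso_lollipop hV hU fun i j hij hj h => ?_
    rcases (by omega : (j = i + 1 ∨ (i = 0 ∧ j = 2)) ∨ (i = 0 ∧ j = 3) ∨ (i = 1 ∧ j = 3)) with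
      h' | ⟨rfl, rfl⟩ | ⟨rfl, rfl⟩
    · exact h'
    · exact absurd (hU.triangle_unique he.pendant h01 h12.symm h h23) hne
    · exact absurd (hU.triangle_unique h12 h01.symm he.pendant.symm h h23) hne'
  have relabel : ∀ a b c : ℕ, a < 4 → b < 4 → c < 4 → a ≠ 2 → b ≠ 2 → c ≠ 2 → a ≠ b → a ≠ c →
      b ≠ c → U.Adj (e a) (e b) → Nonempty (U ≃g lollipop 4) := by
    intro a b c ha hb hc ha2 hb2 hc2 hab hac hbc h
    have hcen : ∀ i < 4, i ≠ 2 → U.Adj (e i) (e 2) := by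
      intro i hi hi2
      rcases (by omega : i = 0 ∨ i = 1 ∨ i = 3) with rfl | rfl | rfl
      · exact he.pendant
      · exact he.path 1 le_rfl (by omega)
      · exact (he.path 2 (by omega) (by omega)).symm
    refine main (fun k => e (if k = 0 then a else if k = 1 then b else if k = 2 then 2 else c))
      ⟨?_, ?_, ?_⟩ h
    · intro i hi j hj hij
      have hi : i < 4 := hi
      have hj : j < 4 := hj
      have := he.injOn
        (show (if i = 0 then a else if i = 1 then b else if i = 2 then 2 else c) < 4 by grind)
        (show (if j = 0 then a else if j = 1 then b else if j = 2 then 2 else c) < 4 by grind) hij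
      grind
    · intro i h1 h2
      rcases (by omega : i = 1 ∨ i = 2) with rfl | rfl
      · exact hcen b hb hb2
      · exact (hcen c hc hc2).symm
    · exact hcen a ha ha2
  by_cases h03 : U.Adj (e 0) (e 3)
  · exact relabel 0 3 1 (by omega) (by omega) (by omega) (by omega) (by omega) (by omega)
      (by omega) (by omega) (by omega) h03
  by_cases h13 : U.Adj (e 1) (e 3)
  · exact relabel 1 3 0 (by omega) (by omega) (by omega) (by omega) (by omega) (by omega)
      (by omega) (by omega) (by omega) h13
  refine he.iso_lollipop hV hU fun i j hij hj h => ?_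
  rcases (by omega : (j = i + 1 ∨ (i = 0 ∧ j = 2)) ∨ (i = 0 ∧ j = 3) ∨ (i = 1 ∧ j = 3)) with
    h' | ⟨rfl, rfl⟩ | ⟨rfl, rfl⟩
  · exact h'
  · exact absurd h h03
  · exact absurd h h13

/-- If the square of `U` has no edge beyond those forced by a spanning fork, then `U` is the
lollipop. -/
lemma IsSpanningFork.iso_lollipop_of_sq {e : ℕ → V} (he : IsSpanningFork U n e) (hn : 5 ≤ n)
    (hV : Fintype.card V = n) (hU : IsUnicyclic U)
    (hsq : ∀ i j, i < j → j < n → j ∉ lolliNbr i → ¬ (graphPower U 2).Adj (e i) (e j)) :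
    Nonempty (U ≃g lollipop n) := by
  have hne : ∀ i j, i < j → j < n → e i ≠ e j := fun i j hij hj h =>
    hij.ne (he.injOn (hij.trans hj) hj h)
  have hno : ∀ i j k, i < j → j < n → i + 2 < j → ¬ (i = 0 ∧ j = 3) → U.Adj (e i) (e k) →
      U.Adj (e k) (e j) → False := fun i j k hij hj h1 h2 h3 h4 =>
    hsq i j hij hj (by rw [mem_lolliNbr]; omega) (sq_adj_of_common h3 h4 (hne i j hij hj))
  refine he.iso_lollipop hV hU fun i j hij hj h => ?_
  have hmem : j ∈ lolliNbr i := by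
    by_contra hcon
    exact hsq i j hij hj hcon (sq_adj_of_adj h)
  rw [mem_lolliNbr] at hmem
  -- Each unwanted chord, followed or preceded by a suitable edge of the fork, joins two vertices
  -- that must not be adjacent in the square.
  rcases (by omega : (j = i + 1 ∨ (i = 0 ∧ j = 2)) ∨ (i = 0 ∧ j = 3) ∨ (i = 1 ∧ j = 3) ∨
    (i = 2 ∧ j = 4) ∨ (3 ≤ i ∧ j = i + 2)) with
    h' | ⟨rfl, rfl⟩ | ⟨rfl, rfl⟩ | ⟨rfl, rfl⟩ | ⟨h3, rfl⟩
  · exact h'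
  · exact (hno 0 4 3 (by omega) (by omega) (by omega) (by omega) h
      (he.path 3 (by omega) (by omega))).elim
  · exact (hno 1 4 3 (by omega) (by omega) (by omega) (by omega) h
      (he.path 3 (by omega) (by omega))).elim
  · exact (hno 0 4 2 (by omega) (by omega) (by omega) (by omega) he.pendant h).elim
  · have := he.path (i - 1) (by omega) (by omega)
    rw [show i - 1 + 1 = i by omega] at this
    exact (hno (i - 1) (i + 2) i (by omega) (by omega) (by omega) (by omega) this h).elim

/-- Among unicyclic graphs with a vertex of degree at least three, the lollipop uniquely minimises
the spectral radius of the square. -/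
theorem IsUnicyclic.rhoSq_lollipop_le (hU : IsUnicyclic U) (hn : 4 ≤ n)
    (hV : Fintype.card V = n) {v a b c : V} (ha : U.Adj v a) (hb : U.Adj v b) (hc : U.Adj v c)
    (hab : a ≠ b) (hac : a ≠ c) (hbc : b ≠ c) :
    rhoSq (lollipop n) ≤ rhoSq U ∧
      (rhoSq U = rhoSq (lollipop n) → Nonempty (U ≃g lollipop n)) := by
  have : Nonempty V := ⟨v⟩
  have : Nonempty (Fin n) := ⟨⟨0, by omega⟩⟩
  obtain ⟨l, w, hl0, hl, hR, hw⟩ := exists_lolliPerron (n := n) (by omega)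
  obtain ⟨m, hm0, hm, hmR, -⟩ := exists_perron (graphPower U 2)
  have hstrict : l < m → rhoSq (lollipop n) < rhoSq U := fun h => by
    rw [hl, rhoSq, hm]
    exact (ENNReal.ofReal_lt_ofReal_iff (hl0.trans_lt h)).2 h
  have hstar : HasCopy U 4 (catPar 2 1 0 0) := by
    refine ⟨fun k => if k = 0 then a else if k = 1 then v else if k = 2 then b else c, ?_, ?_⟩
    · have h1 := ha.ne
      have h2 := hb.ne
      have h3 := hc.ne
      intro i hi j hj hij
      have hi : i < 4 := hi
      have hj : j < 4 := hj
      grind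
    · intro k h0 hk
      interval_cases k
      · exact ha.symm
      · exact hb
      · exact hc
  rcases hw.lt_or_spanningFork hR hn hV hU.1.preconnected hmR hstar with h | ⟨e, he⟩
  · exact ⟨(hstrict h).le, fun heq => absurd heq (hstrict h).ne'⟩
  refine ⟨rho_le_of_injective (he.bijective hV).1 fun i j hij => ?_, fun heq => ?_⟩
  · rw [lollipop_sq_adj] at hij
    rcases lt_trichotomy i.1 j.1 with h | h | h
    · exact he.sq_adj (by omega) i i.2 j j.2 h hij
    · exact absurd h (mem_lolliNbr.1 hij).1
    · refine (he.sq_adj (by omega) j j.2 i i.2 h ?_).symm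
      rw [mem_lolliNbr] at hij ⊢; omega
  · rcases hn.eq_or_lt with rfl | hn
    · exact he.iso_lollipop_four hV hU
    · refine he.iso_lollipop_of_sq hn hV hU fun i j hij hj hmem hadj => ?_
      exact (hstrict (hw.lt_of_extra_edge hmR he.injOn
        (fun i hi j hj hij hmem => he.sq_adj (by omega) i hi j hj hij hmem)
        (hij.trans hj) hj hmem hadj)).ne' heq

end extremal

/-! ### The coalescence as a lollipop, and the main theorem. -/

lemma pendant_pathGraph {k : ℕ} {v : Fin k} (hv : IsPendant (SimpleGraph.pathGraph k) v) :
    v.1 = 0 ∨ v.1 + 1 = k := by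
  by_contra hcon
  push Not at hcon
  have h1 : (SimpleGraph.pathGraph k).Adj v ⟨v.1 - 1, by omega⟩ :=
    SimpleGraph.pathGraph_adj.2 (Or.inr (by simp only; omega))
  have h2 : (SimpleGraph.pathGraph k).Adj v ⟨v.1 + 1, by omega⟩ :=
    SimpleGraph.pathGraph_adj.2 (Or.inl rfl)
  have := congrArg Fin.val (hv.unique h1 h2)
  simp only at this
  omega

lemma trianglePath_iso_lollipop {n : ℕ} (hn : 4 ≤ n) (c : Fin 3) (v : Fin (n - 2))
    (hv : IsPendant (SimpleGraph.pathGraph (n - 2)) v) :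
    Nonempty (trianglePath n c v ≃g lollipop n) := by
  have hv' := pendant_pathGraph hv
  -- The rotation sends `c` to 2. The two truncated differences add up to the distance from `v`,
  -- which is injective because `v` is an end of the path.
  let g : Fin 3 ⊕ {w : Fin (n - 2) // w ≠ v} → Fin n := fun s => match s with
    | Sum.inl a => ⟨(a.1 + (5 - c.1)) % 3, by omega⟩
    | Sum.inr w => ⟨2 + (w.1.1 - v.1) + (v.1 - w.1.1), by have := w.1.2; omega⟩
  have hgl : ∀ a : Fin 3, (g (Sum.inl a)).1 = (a.1 + (5 - c.1)) % 3 := fun _ => rfl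
  have hgr : ∀ w : {w : Fin (n - 2) // w ≠ v},
      (g (Sum.inr w)).1 = 2 + (w.1.1 - v.1) + (v.1 - w.1.1) := fun _ => rfl
  have hc := c.2
  have hwv : ∀ w : {w : Fin (n - 2) // w ≠ v}, w.1.1 ≠ v.1 := fun w => Fin.val_ne_of_ne w.2
  have hinj : Function.Injective g := by
    rintro (a | x) (b | y) h
    · have := congrArg Fin.val h
      rw [hgl, hgl] at this
      have ha := a.2
      have hb := b.2
      rw [Fin.ext (by omega : a.1 = b.1)]
    · have := congrArg Fin.val h
      rw [hgl, hgr] at this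
      have hy := hwv y
      omega
    · have := congrArg Fin.val h
      rw [hgl, hgr] at this
      have hx := hwv x
      omega
    · have := congrArg Fin.val h
      rw [hgr, hgr] at this
      have hx := x.1.2
      have hy := y.1.2
      rw [Subtype.ext (Fin.ext (by omega : x.1.1 = y.1.1))]
  have hbij : Function.Bijective g := (Fintype.bijective_iff_injective_and_card _).2
    ⟨hinj, by simp; omega⟩
  refine ⟨⟨Equiv.ofBijective g hbij, fun {s t} => ?_⟩⟩
  show (lollipop n).Adj (g s) (g t) ↔ _
  rw [lollipop_adj]
  rcases s with a | x <;> rcases t with b | y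
  · rw [hgl, hgl]
    show _ ↔ (SimpleGraph.cycleGraph 3).Adj a b
    rw [SimpleGraph.cycleGraph_three_eq_top, SimpleGraph.top_adj, Ne, Fin.ext_iff]
    have ha := a.2
    have hb := b.2
    omega
  · rw [hgl, hgr]
    show _ ↔ a = c ∧ (SimpleGraph.pathGraph (n - 2)).Adj v y.1
    rw [SimpleGraph.pathGraph_adj, Fin.ext_iff]
    have ha := a.2
    have hy := hwv y
    have hy' := y.1.2
    omega
  · rw [hgl, hgr]
    show _ ↔ b = c ∧ (SimpleGraph.pathGraph (n - 2)).Adj v x.1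
    rw [SimpleGraph.pathGraph_adj, Fin.ext_iff]
    have hb := b.2
    have hx := hwv x
    have hx' := x.1.2
    omega
  · rw [hgr, hgr]
    show _ ↔ (SimpleGraph.pathGraph (n - 2)).Adj x.1 y.1
    rw [SimpleGraph.pathGraph_adj]
    have hx := hwv x
    have hx' := x.1.2
    have hy := hwv y
    have hy' := y.1.2
    omega

end SquareSpectral

theorem theorem4p4 {V : Type*} [Fintype V] (n : ℕ) (hn : 4 ≤ n) (hV : Fintype.card V = n)
    (U : SimpleGraph V) (hU : SquareSpectral.IsUnicyclic U)
    (c : Fin 3) (v : Fin (n - 2))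
    (hv : SquareSpectral.IsPendant (SimpleGraph.pathGraph (n - 2)) v) :
    min (SquareSpectral.rhoSq (SquareSpectral.trianglePath n c v))
        (SquareSpectral.rhoSq (SimpleGraph.cycleGraph n)) ≤ SquareSpectral.rhoSq U ∧
      (SquareSpectral.rhoSq U =
          min (SquareSpectral.rhoSq (SquareSpectral.trianglePath n c v))
            (SquareSpectral.rhoSq (SimpleGraph.cycleGraph n)) ↔
        (Nonempty (U ≃g SquareSpectral.trianglePath n c v) ∧
            SquareSpectral.rhoSq (SquareSpectral.trianglePath n c v) ≤
              SquareSpectral.rhoSq (SimpleGraph.cycleGraph n)) ∨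
          (Nonempty (U ≃g SimpleGraph.cycleGraph n) ∧
            SquareSpectral.rhoSq (SimpleGraph.cycleGraph n) ≤
              SquareSpectral.rhoSq (SquareSpectral.trianglePath n c v))) := by
  have : Nonempty V := hU.1.nonempty
  have : Nonempty (Fin n) := ⟨⟨0, by omega⟩⟩
  obtain ⟨φ⟩ := SquareSpectral.trianglePath_iso_lollipop hn c v hv
  have hφ : SquareSpectral.rhoSq (SquareSpectral.trianglePath n c v)
      = SquareSpectral.rhoSq (SquareSpectral.lollipop n) :=
    (SquareSpectral.rhoSq_congr φ.symm).symm
  have hback : (Nonempty (U ≃g SquareSpectral.trianglePath n c v) ∧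
      SquareSpectral.rhoSq (SquareSpectral.trianglePath n c v) ≤
        SquareSpectral.rhoSq (SimpleGraph.cycleGraph n)) ∨
      (Nonempty (U ≃g SimpleGraph.cycleGraph n) ∧
      SquareSpectral.rhoSq (SimpleGraph.cycleGraph n) ≤
        SquareSpectral.rhoSq (SquareSpectral.trianglePath n c v)) →
      SquareSpectral.rhoSq U = min (SquareSpectral.rhoSq (SquareSpectral.trianglePath n c v))
        (SquareSpectral.rhoSq (SimpleGraph.cycleGraph n)) := by
    rintro (⟨⟨ψ⟩, h⟩ | ⟨⟨ψ⟩, h⟩)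
    · rw [SquareSpectral.rhoSq_congr ψ, min_eq_left h]
    · rw [SquareSpectral.rhoSq_congr ψ, min_eq_right h]
  -- Either all degrees are at most two and `U` is a cycle, or some vertex has three neighbours and
  -- the lollipop bound applies.
  by_cases hdeg : ∀ v a b c, U.Adj v a → U.Adj v b → U.Adj v c → a ≠ b → a ≠ c → b = c
  · obtain ⟨ψ⟩ := hU.iso_cycleGraph hV hdeg
    have hψ := SquareSpectral.rhoSq_congr ψ
    refine ⟨(min_le_right _ _).trans hψ.ge, fun h => Or.inr ⟨⟨ψ⟩, ?_⟩, hback⟩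
    rw [hψ] at h
    exact h.le.trans (min_le_left _ _)
  · push Not at hdeg
    obtain ⟨v, a, b, c, ha, hb, hc, hab, hac, hbc⟩ := hdeg
    obtain ⟨h1, h2⟩ := hU.rhoSq_lollipop_le hn hV ha hb hc hab hac hbc
    rw [← hφ] at h1 h2
    refine ⟨(min_le_left _ _).trans h1, fun h => ?_, hback⟩
    have heq := le_antisymm (h.le.trans (min_le_left _ _)) h1
    obtain ⟨ψ⟩ := h2 heq
    exact Or.inl ⟨⟨ψ.trans φ.symm⟩, heq ▸ h.le.trans (min_le_right _ _)⟩
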